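/- Consider an episodic two-player Markov game with horizon $H\ge 1$ and finite sets: states $S=\bigcup_{h=1}^{H+1}S_h$ (with $S_{H+1}$ a single terminal state), learner actions $A=\bigcup_{h=1}^H A_h$, opponent actions $B=\bigcup_{h=1}^H B_h$, transitions $P_h:S_h\times A_h\times B_h\to\Delta(S_{h+1})$ and rewards $r_h:S_h\times A_h\times B_h\to[0,1]$. In episodes $k=1,\dots,K$ ($K\ge1$), an adversary picks the initial state $s_1^k\in S_1$ (possibly depending on all previous episodes, possibly at random), the learner commits to a policy $\mu^k$ and the opponent to a policy $\nu^k$ (both may depend on the previous episodes), and one trajectory is played; the learner observes states, its own actions and rewards, but not the opponent's actions. Let $V_h^{\mu,\nu}(s)$ be the expected total reward from step $h$ and state $s$ under $(\mu,\nu)$. With $V^*_{H+1}=0$, define the empirical Nash values $$V_h^*(s)=\max_{\mu\in\Delta(A_h)}\ \min_{\nu\in\{\nu_h^k(s)\}_{k\le K}}\ \mathbb E_{a\sim\mu,\,b\sim\nu}\Big[r_h(s,a,b)+\mathbb E_{s'\sim P_h(\cdot\mid s,a,b)}V^*_{h+1}(s')\Big],$$ the empirical Nash-value regret and the external regret (maximum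 over all learner policies $\mu$) $$\mathrm{ENR}_K=\sum_{k=1}^K\big(V_1^*(s_1^k)-V_1^{\mu^k,\nu^k}(s_1^k)\big),\qquad \mathrm{ExtR}_K=\max_\mu\sum_{k=1}^K\big(V_1^{\mu,\nu^k}(s_1^k)-V_1^{\mu^k,\nu^k}(s_1^k)\big).$$ Epoch V-learning with parameters $\eta,\iota$ does the following. For each $(h,s)$ it keeps an estimate $V_h(s)$, initially $H-h+1$ (with $V_{H+1}=0$), and splits the visits to $(h,s)$ into epochs: with $N_0=1$, epoch $\tau\ge1$ ends once its number of visits $N_\tau$ equals $\lceil(1+\eta)N_{\tau-1}\rceil$. When epoch $\tau$ ends, $V_h(s)$ is set to the minimum of $H-h+1$ and the average over the visits of the epoch of (reward $+$ estimate $V_{h+1}$ of the next state held during that episode) plus $\sqrt{\iota/N_\tau}$. In each epoch the actions at $(h,s)$ are drawn from the policy of a fresh adversarial bandit algorithm, started at the uniform policy on $A_h$, which after each visit is fed the played action and the reward $\frac1H(r_h+V_{h+1}(s_{h+1}))\in[0,1]$. The bandit algorithm is follow-the-regularized-leader over $\Delta(A_h)$ with the $\frac12$-Tsallis entropy regularizer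 $\psi(p)=2(1-\sum_a\sqrt{p_a})$ and implicit-exploration loss estimates $\hat\ell(a)=\ell\,\mathbf 1\{a\text{ is played}\}/(p_a+\gamma)$, where $\ell$ is one minus the reward, with doubling: it restarts on consecutive blocks of $N=1,2,4,\dots$ rounds, with learning rate $1/\sqrt N$ and $\gamma=\sqrt{\log(|A_h|/\delta')/(|A_h|N)}$, where $\delta'=\delta/(4HK|S|)$. Write $\Lambda=\log(8HK|A||S|/\delta)$. There is an absolute constant $c_0>0$ such that for every $c_1\ge c_0$ there are constants $C>0$ and $p\in\mathbb N$, depending only on $c_1$, for which the following holds for every such game, every $K\ge1$, every $\delta\in(0,1)$, every adversarial choice of the initial states, and every $\iota$ with $c_0H^2|A|\Lambda\le\iota\le c_1H^2|A|\Lambda$ (that is, $\iota=\Theta(H^2|A|\log(HK|A||S|/\delta))$). If the opponent plays one fixed policy, $\nu^1=\dots=\nu^K$, then Epoch V-learning with $\eta=1/H$ satisfies $\mathrm{ExtR}_K=\mathrm{ENR}_K$ almost surely, and with probability at least $1-\delta$ $$\mathrm{ExtR}_K=\mathrm{ENR}_K\le C\,\sqrt{H^5|A||S|K}\;\Lambda^{p},\qquad\text{i.e.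 }\ \mathrm{ExtR}_K=\mathrm{ENR}_K=\tilde O\big(\sqrt{H^5|A||S|K}\big).$$ In particular (the case in which the opponent has a single action at every state) this is a $\sqrt K$-type external regret bound for V-learning on a fixed Markov decision process. -/

import Mathlib

noncomputable section

/-! ### Two-player Markov games

Steps are numbered `0, …, H - 1` and layer `H` is terminal, so step `h` here is the step usually
written `h + 1`. Data attached to steps outside `{0, …, H - 1}` are never used. -/

/-- An episodic two-player Markov game of horizon `H`. The sets of states of different steps may
be disjoint or may overlap, and likewise for the actions. -/
structure MarkovGame (S A B : Type*) (H : ℕ) where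
  /-- states of step `h`, for `h = 0, …, H` -/
  states : ℕ → Finset S
  /-- actions of the learner (max-player) at step `h` -/
  actions : ℕ → Finset A
  /-- actions of the opponent (min-player) at step `h` -/
  oppActions : ℕ → Finset B
  transition : ℕ → S → A → B → PMF S
  reward : ℕ → S → A → B → ℝ
  actions_nonempty : ∀ h, (actions h).Nonempty
  terminal_unique : (states H).card = 1
  transition_support : ∀ h < H, ∀ s ∈ states h, ∀ a ∈ actions h, ∀ b ∈ oppActions h,
    (transition h s a b).support ⊆ (states (h + 1) : Set S)
  reward_mem : ∀ h < H, ∀ s ∈ states h, ∀ a ∈ actions h, ∀ b ∈ oppActions h,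
    reward h s a b ∈ Set.Icc (0 : ℝ) 1

/-- A Markov policy: a distribution over actions for each step and state. -/
abbrev Policy (S X : Type*) := ℕ → S → PMF X

/-- A trajectory of one episode: state, learner's action and opponent's action at each step. -/
abbrev Episode (S A B : Type*) (H : ℕ) := Fin H → S × A × B

/-- The record of the first `k` episodes. -/
abbrev History (S A B : Type*) (H k : ℕ) := Fin k → Episode S A B H

namespace MarkovGame

variable {S A B : Type*} {H : ℕ}

/-- `|S|`, the number of states in the union of all layers (terminal layer included). -/
def numStates [DecidableEq S] (G : MarkovGame S A B H) : ℕ :=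
  ((Finset.range (H + 1)).biUnion G.states).card

/-- `|A|`, the number of actions in the union of the learner's action sets. -/
def numActions [DecidableEq A] (G : MarkovGame S A B H) : ℕ :=
  ((Finset.range H).biUnion G.actions).card

/-- `μ` is a policy of the learner in the game: at each state of step `h` it plays in `A_h`. -/
def IsLearnerPolicy (G : MarkovGame S A B H) (μ : Policy S A) : Prop :=
  ∀ h < H, ∀ s ∈ G.states h, (μ h s).support ⊆ (G.actions h : Set A)

/-- `ν` is a policy of the opponent in the game. -/
def IsOppPolicy (G : MarkovGame S A B H) (ν : Policy S B) : Prop :=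
  ∀ h < H, ∀ s ∈ G.states h, (ν h s).support ⊆ (G.oppActions h : Set B)

/-- The law of the next `n` steps of play when `μ` and `ν` are followed from state `s` at
step `h`. -/
def rollout (G : MarkovGame S A B H) (μ : Policy S A) (ν : Policy S B) :
    (n : ℕ) → ℕ → S → PMF (Fin n → S × A × B)
  | 0, _, _ => PMF.pure Fin.elim0
  | n + 1, h, s =>
      (μ h s).bind fun a => (ν h s).bind fun b => (G.transition h s a b).bind fun s' =>
        (rollout G μ ν n (h + 1) s').map
          (Fin.cons (α := fun _ : Fin (n + 1) => S × A × B) (s, a, b))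

variable [Fintype S] [Fintype A] [Fintype B]

/-- The value `V_h^{μ,ν}(s)`: the expected total reward from step `h` to the end of the episode
when `μ` and `ν` are followed from `s`. -/
def value (G : MarkovGame S A B H) (μ : Policy S A) (ν : Policy S B) (h : ℕ) (s : S) : ℝ :=
  ∑ t : Fin (H - h) → S × A × B, (G.rollout μ ν (H - h) h s t).toReal *
    ∑ i : Fin (H - h), G.reward (h + i) (t i).1 (t i).2.1 (t i).2.2

/-- `(P_h V)(s, a, b)`. -/
def expectNext (G : MarkovGame S A B H) (h : ℕ) (V : S → ℝ) (s : S) (a : A) (b : B) : ℝ :=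
  ∑ s', (G.transition h s a b s').toReal * V s'

/-- `D_{μ,ν}[Q]`, the mean of `Q a b` under independent `a ∼ μ` and `b ∼ ν`. -/
def mixedMean (μ : PMF A) (ν : PMF B) (Q : A → B → ℝ) : ℝ :=
  ∑ a, ∑ b, (μ a).toReal * (ν b).toReal * Q a b

/-- Empirical Nash value at step `h` with `n` steps remaining, for the opponent policies
`ν 0, …, ν (K - 1)` of the `K` episodes: the learner maximizes over `Δ(A_h)`, and the opponent
minimizes over the distributions `ν k h s` that were played at `(h, s)`. -/
def empNashAux (G : MarkovGame S A B H) {K : ℕ} (ν : Fin K → Policy S B) : ℕ → ℕ → S → ℝ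
  | 0, _, _ => 0
  | n + 1, h, s =>
      ⨆ μ : {μ : PMF A // μ.support ⊆ (G.actions h : Set A)}, ⨅ k : Fin K,
        mixedMean μ.1 (ν k h s) fun a b =>
          G.reward h s a b + G.expectNext h (empNashAux G ν n (h + 1)) s a b

/-- The empirical Nash value `V*_h(s)`. -/
def empNash (G : MarkovGame S A B H) {K : ℕ} (ν : Fin K → Policy S B) (h : ℕ) (s : S) : ℝ :=
  G.empNashAux ν (H - h) h s

/-- Empirical Nash-value regret, for initial states `s₁`, learner policies `μ` and opponent
policies `ν` of the `K` episodes. -/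
def empNashRegret (G : MarkovGame S A B H) {K : ℕ} (s₁ : Fin K → S) (μ : Fin K → Policy S A)
    (ν : Fin K → Policy S B) : ℝ :=
  ∑ k, (G.empNash ν 0 (s₁ k) - G.value (μ k) (ν k) 0 (s₁ k))

/-- External regret, against the best fixed policy of the learner. -/
def externalRegret (G : MarkovGame S A B H) {K : ℕ} (s₁ : Fin K → S) (μ : Fin K → Policy S A)
    (ν : Fin K → Policy S B) : ℝ :=
  ⨆ μ' : {μ' : Policy S A // G.IsLearnerPolicy μ'},
    ∑ k, (G.value μ'.1 (ν k) 0 (s₁ k) - G.value (μ k) (ν k) 0 (s₁ k))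

end MarkovGame

/-- The law of `K` episodes of play. Before each episode the learner and the opponent commit to
policies and the adversary picks a (possibly random) initial state, all as functions of the
record of the previous episodes. -/
def interactionLaw {S A B : Type*} {H : ℕ} (G : MarkovGame S A B H)
    (learner : (k : ℕ) → History S A B H k → Policy S A)
    (opponent : (k : ℕ) → History S A B H k → Policy S B)
    (initial : (k : ℕ) → History S A B H k → PMF S) : (K : ℕ) → PMF (History S A B H K)
  | 0 => PMF.pure Fin.elim0
  | k + 1 =>
      (interactionLaw G learner opponent initial k).bind fun ω =>
        (initial k ω).bind fun s =>
          (G.rollout (learner k ω) (opponent k ω) H 0 s).map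
            (Fin.snoc (α := fun _ : Fin (k + 1) => Episode S A B H) ω)

/-- The initial states of the `K` episodes of a record. -/
def initialStates {S A B : Type*} {H K : ℕ} [NeZero H] (ω : History S A B H K) : Fin K → S :=
  fun k => (ω k 0).1

/-- The policies of the `K` episodes that a strategy commits to along a record. -/
def playedPolicies {S A B X : Type*} {H K : ℕ}
    (strategy : (k : ℕ) → History S A B H k → Policy S X) (ω : History S A B H K) :
    Fin K → Policy S X :=
  fun k => strategy k (Fin.take (α := fun _ : Fin K => Episode S A B H) k k.is_lt.le ω)

/-! ### The adversarial bandit subroutine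

Follow-the-regularized-leader with the `1/2`-Tsallis entropy regularizer and implicit-exploration
loss estimates, restarted on consecutive blocks of `1, 2, 4, 8, …` rounds. -/

section Bandit

variable {A : Type*} [Fintype A]

/-- The probability vectors on `A` that vanish outside `X`, that is, `Δ(X)`. -/
def simplexOn (X : Finset A) : Set (A → ℝ) :=
  {p | (∀ a, 0 ≤ p a) ∧ (∀ a ∉ X, p a = 0) ∧ ∑ a, p a = 1}

/-- The negative `β`-Tsallis entropy `(1 - ∑ₐ p(a)^β) / (1 - β)` for `β = 1/2`. -/
def tsallisHalf (p : A → ℝ) : ℝ := (1 - ∑ a, √(p a)) / (1 - 1 / 2)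

/-- The objective of follow-the-regularized-leader with learning rate `lr` and cumulative
estimated losses `L`. -/
def ftrlObjective (lr : ℝ) (L p : A → ℝ) : ℝ := ∑ a, p a * L a + tsallisHalf p / lr

theorem exists_ftrl (X : Finset A) (hX : X.Nonempty) (lr : ℝ) (L : A → ℝ) :
    ∃ p ∈ simplexOn X, IsMinOn (ftrlObjective lr L) (simplexOn X) p := by
  classical
  have hc : IsCompact (simplexOn X) := by
    have h : simplexOn X = stdSimplex ℝ A ∩ ⋂ a ∈ (X : Set A)ᶜ, {p : A → ℝ | p a = 0} := by
      ext p
      simp only [simplexOn, stdSimplex, Set.mem_ofPred_eq, Set.mem_inter_iff, Set.mem_iInter,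
        Set.mem_compl_iff, Finset.mem_coe]
      tauto
    rw [h]
    refine (isCompact_stdSimplex ℝ A).inter_right (isClosed_biInter fun a _ => ?_)
    exact isClosed_eq (continuous_apply a) continuous_const
  refine hc.exists_isMinOn ?_ ?_
  · obtain ⟨a, ha⟩ := hX
    refine ⟨Pi.single a 1, fun b => ?_, fun b hb => ?_, by simp⟩
    · by_cases hb : b = a
      · subst hb; simp
      · simp [hb]
    · have hne : b ≠ a := fun h => hb (h ▸ ha)
      simp [hne]
  · unfold ftrlObjective tsallisHalf
    fun_prop

/-- The minimizer over `Δ(X)` (unique for `lr > 0`) of the objective. -/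
def ftrlPoint (X : Finset A) (hX : X.Nonempty) (lr : ℝ) (L : A → ℝ) : A → ℝ :=
  (exists_ftrl X hX lr L).choose

theorem ftrlPoint_mem (X : Finset A) (hX : X.Nonempty) (lr : ℝ) (L : A → ℝ) :
    ftrlPoint X hX lr L ∈ simplexOn X :=
  (exists_ftrl X hX lr L).choose_spec.1

/-- The same minimizer as a probability distribution. -/
def ftrlPolicy (X : Finset A) (hX : X.Nonempty) (lr : ℝ) (L : A → ℝ) : PMF A :=
  PMF.ofFintype (fun a => ENNReal.ofReal (ftrlPoint X hX lr L a)) (by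
    have h := ftrlPoint_mem X hX lr L
    rw [← ENNReal.ofReal_sum_of_nonneg fun a _ => h.1 a, h.2.2, ENNReal.ofReal_one])

/-- State of the bandit subroutine: it is in the block of `2 ^ block` rounds, of which `round` are
over, with cumulative estimated losses `loss` over this block; `policy` is its current output. -/
structure BanditState (A : Type*) where
  block : ℕ
  round : ℕ
  loss : A → ℝ
  policy : PMF A

/-- A freshly started subroutine; it plays uniformly. -/
def BanditState.fresh (X : Finset A) (hX : X.Nonempty) : BanditState A where
  block := 0
  round := 0
  loss := 0
  policy := PMF.uniformOfFinset X hX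

/-- Update after action `a` brought the (normalized) reward `x`, that is, the loss `1 - x`. In a
block of `N` rounds the learning rate is `1 / √N` and the implicit-exploration parameter is
`√(log (|X| / δ') / (|X| N))`. -/
def BanditState.update [DecidableEq A] (X : Finset A) (hX : X.Nonempty) (δ' : ℝ) (a : A) (x : ℝ)
    (st : BanditState A) : BanditState A :=
  let N : ℝ := 2 ^ st.block
  let γ : ℝ := √(Real.log (X.card / δ') / (X.card * N))
  let L : A → ℝ := Function.update st.loss a
    (st.loss a + (1 - x) / ((st.policy a).toReal + γ))
  if st.round + 1 = 2 ^ st.block then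
    { block := st.block + 1
      round := 0
      loss := 0
      policy := ftrlPolicy X hX (1 / √(2 ^ (st.block + 1))) 0 }
  else
    { block := st.block
      round := st.round + 1
      loss := L
      policy := ftrlPolicy X hX (1 / √N) L }

end Bandit

/-! ### Epoch V-learning -/

/-- What the algorithm stores for one pair `(h, s)`: the current estimate `V_h(s)`, the length
`N_{τ-1}(h, s)` of the previous epoch, the number `N_τ(h, s)` of visits in the current epoch, the
sum of `r + V_{h+1}(s')` over these visits, and the bandit subroutine, whose output is the
current policy at `(h, s)`. -/
structure EpochState (A : Type*) where
  V : ℝ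
  prevCount : ℕ
  count : ℕ
  total : ℝ
  bandit : BanditState A

section EpochVLearning

variable {S A B : Type*} [Fintype A] [DecidableEq A] {H : ℕ}

/-- Update of the data of `(h, s)` after a visit with action `a`, reward `r` and next-state
estimate `v = V_{h+1}(s')`. Here `η` is the epoch incremental factor, `ι` the confidence width
parameter, and `δ'` the confidence parameter of the bandit subroutine. -/
def EpochState.update (H h : ℕ) (X : Finset A) (hX : X.Nonempty) (η ι δ' : ℝ) (a : A) (r v : ℝ)
    (c : EpochState A) : EpochState A :=
  let n : ℕ := c.count + 1
  let w : ℝ := c.total + (r + v)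
  if n = ⌈(1 + η) * (c.prevCount : ℝ)⌉₊ then
    { V := min ((H : ℝ) - h) (w / n + √(ι / n))
      prevCount := n
      count := 0
      total := 0
      bandit := BanditState.fresh X hX }
  else
    { V := c.V
      prevCount := c.prevCount
      count := n
      total := w
      bandit := c.bandit.update X hX δ' a ((r + v) / H) }

/-- Initial data of the algorithm. -/
def epochInit (G : MarkovGame S A B H) : ℕ → S → EpochState A := fun h _ =>
  { V := (H : ℝ) - h
    prevCount := 1
    count := 0
    total := 0
    bandit := BanditState.fresh (G.actions h) (G.actions_nonempty h) }

/-- What the learner sees of an episode: states, own actions and rewards, but not the actions of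
the opponent. -/
def observed (G : MarkovGame S A B H) (e : Episode S A B H) : Fin H → S × A × ℝ :=
  fun h => ((e h).1, (e h).2.1, G.reward h (e h).1 (e h).2.1 (e h).2.2)

variable [DecidableEq S]

/-- Update of all data after an episode with observations `o`: only the pairs `(h, s_h)` that were
visited change, and the next-state estimates are those held during the episode (zero at the
terminal layer). -/
def epochStep (G : MarkovGame S A B H) (η ι δ' : ℝ) (c : ℕ → S → EpochState A)
    (o : Fin H → S × A × ℝ) : ℕ → S → EpochState A := fun h s =>
  if hh : h < H then
    if s = (o ⟨h, hh⟩).1 then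
      (c h s).update H h (G.actions h) (G.actions_nonempty h) η ι δ'
        (o ⟨h, hh⟩).2.1 (o ⟨h, hh⟩).2.2
        (if hn : h + 1 < H then (c (h + 1) (o ⟨h + 1, hn⟩).1).V else 0)
    else c h s
  else c h s

/-- The data of the algorithm after the first `k` episodes. -/
def epochData (G : MarkovGame S A B H) (η ι δ' : ℝ) :
    (k : ℕ) → History S A B H k → ℕ → S → EpochState A
  | 0, _ => epochInit G
  | k + 1, ω => epochStep G η ι δ' (epochData G η ι δ' k fun i => ω i.castSucc)
      (observed G (ω (Fin.last k)))

/-- Epoch V-learning for `K` episodes with confidence `δ`: the policy committed to after the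
record of `k` episodes. Each bandit instance is run with confidence `δ / (4 H K |S|)`. -/
def epochVLearning (G : MarkovGame S A B H) (K : ℕ) (δ η ι : ℝ) :
    (k : ℕ) → History S A B H k → Policy S A := fun k ω h s =>
  (epochData G η ι (δ / (4 * H * K * G.numStates)) k ω h s).bandit.policy

end EpochVLearning

/-- The logarithmic factor `log (8 H K |A| |S| / δ)`. -/
def logFactor {S A B : Type*} [DecidableEq S] [DecidableEq A] {H : ℕ} (G : MarkovGame S A B H)
    (K : ℕ) (δ : ℝ) : ℝ :=
  Real.log (8 * H * K * G.numActions * G.numStates / δ)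

end

/-!
Against a fixed opponent `ν` the learner faces a Markov decision process with optimal values `V*`,
and the empirical Nash value is `V*` because its inner minimum is over one distribution. One
deterministic policy attains `V*` from every state, so both regrets equal
`∑ₖ (V*₁ - V₁^{μᵏ,ν})` (`MarkovGame.externalRegret_const`).

*Bandit regret.* Stability of Tsallis-regularized leader following (`ftrl_stability`) bounds the
realized losses of a block by those of an optimal action plus weighted loss estimates. By the
implicit-exploration inequality (`exp_ix_le`) the exponential of the weighted estimation error
(`deviation`) is a supermartingale between resets at the starts of blocks, and a reset adds at most
`1` to its mean; so all errors, at all times, are logarithmic with high probability. Then in each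
epoch, complete or not, the collected `r + V_{h+1}` falls short of `V*_h` per visit by at most
`√(ι N)` in total, and the estimates are optimistic (`GoodHistory.visitInv`).

*Epochs.* For a complete epoch of length `N` the sum of `V_h - r - V_{h+1}` is at most
`N (V_h - V_h') + √(ι N)`, with `V_h'` the next estimate. Summed by parts over the epochs, this
leaves `(N_τ - N_{τ-1}) φ`, where `φ = V_h - V*_h ≥ 0`, and `N_τ - N_{τ-1} ≤ N_τ / (H + 1) + 1`.
As there are `O(H log K)` epochs at each state, `√N ≤ (θ N + 1 / θ) / 2` bounds the bonuses
linearly in the visits; `θ` is chosen at the end (`EpochInv`).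

*Recursion over steps.* Let `Δ_h` be the sum over the episodes of `V_h - V_h^{μᵏ,ν}` at the visited
states. Since `φ` is at most the summand of `Δ_h`, the previous bound gives
`Δ_h ≤ Δ_{h+1} + Δ_h / (H + 1) + (bonuses) + (temporal-difference errors of the played values)`,
that is, growth by a factor `1 + 1 / H` per step (`valueGap_le`, `le_of_backward_recursion`). The
errors are controlled by exponential moments (`expect_exp_valueNoise_le`), and `Δ` at the first step
bounds the regret by optimism. If `K` is less than `H |S|` or than the logarithmic factor, the
trivial bound `H K` suffices.
-/

noncomputable section

/-! ### Expectations under finitely supported laws -/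

/-- The mean of a real function under a law on a finite type. -/
def expect {α : Type*} [Fintype α] (p : PMF α) (f : α → ℝ) : ℝ := ∑ x, (p x).toReal * f x

section Expect

variable {α β : Type*} [Fintype α] [Fintype β]

theorem sum_toReal_pmf (p : PMF α) : ∑ x, (p x).toReal = 1 := by
  rw [← ENNReal.toReal_sum fun x _ => p.apply_ne_top x, ← tsum_fintype (L := .unconditional α),
    p.tsum_coe, ENNReal.toReal_one]

theorem expect_const (p : PMF α) (c : ℝ) : expect p (fun _ => c) = c := by
  rw [expect, ← Finset.sum_mul, sum_toReal_pmf, one_mul]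

theorem expect_mono {p : PMF α} {f g : α → ℝ} (h : ∀ x ∈ p.support, f x ≤ g x) :
    expect p f ≤ expect p g := by
  refine Finset.sum_le_sum fun x _ => ?_
  by_cases hx : x ∈ p.support
  · exact mul_le_mul_of_nonneg_left (h x hx) ENNReal.toReal_nonneg
  · rw [PMF.mem_support_iff, not_not] at hx
    simp [hx]

theorem expect_le {p : PMF α} {f : α → ℝ} {c : ℝ} (h : ∀ x ∈ p.support, f x ≤ c) :
    expect p f ≤ c :=
  (expect_mono h).trans_eq (expect_const p c)

theorem le_expect {p : PMF α} {f : α → ℝ} {c : ℝ} (h : ∀ x ∈ p.support, c ≤ f x) :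
    c ≤ expect p f :=
  (expect_const p c).symm.trans_le (expect_mono h)

theorem expect_add (p : PMF α) (f g : α → ℝ) :
    expect p (fun x => f x + g x) = expect p f + expect p g := by
  simp only [expect, mul_add, Finset.sum_add_distrib]

theorem expect_sub (p : PMF α) (f g : α → ℝ) :
    expect p (fun x => f x - g x) = expect p f - expect p g := by
  simp only [expect, mul_sub, Finset.sum_sub_distrib]

theorem expect_const_mul (p : PMF α) (c : ℝ) (f : α → ℝ) :
    expect p (fun x => c * f x) = c * expect p f := by
  simp only [expect, Finset.mul_sum]
  exact Finset.sum_congr rfl fun x _ => by ring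

theorem expect_sum {κ : Type*} (p : PMF α) (t : Finset κ) (f : κ → α → ℝ) :
    expect p (fun x => ∑ i ∈ t, f i x) = ∑ i ∈ t, expect p (f i) := by
  simp only [expect, Finset.mul_sum]
  exact Finset.sum_comm

theorem expect_pure (a : α) (f : α → ℝ) : expect (PMF.pure a) f = f a := by
  classical
  rw [expect, Finset.sum_eq_single a]
  · simp
  · intro b _ hb
    simp [hb]
  · simp

theorem expect_bind (p : PMF α) (q : α → PMF β) (f : β → ℝ) :
    expect (p.bind q) f = expect p fun x => expect (q x) f := by
  simp only [expect, Finset.mul_sum]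
  rw [Finset.sum_comm]
  refine Finset.sum_congr rfl fun y _ => ?_
  rw [PMF.bind_apply, tsum_fintype, ENNReal.toReal_sum fun x _ =>
    ENNReal.mul_ne_top (p.apply_ne_top x) ((q x).apply_ne_top y), Finset.sum_mul]
  exact Finset.sum_congr rfl fun x _ => by rw [ENNReal.toReal_mul, mul_assoc]

theorem expect_map (p : PMF α) (g : α → β) (f : β → ℝ) :
    expect (p.map g) f = expect p fun x => f (g x) := by
  rw [PMF.map, expect_bind]
  simp only [Function.comp_apply, expect_pure]

/-- Markov's inequality in the form used for the final confidence statement: an event that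
contains every point of the support where `f ≤ 1` is at least as likely as `1 - E f`. -/
theorem le_toOuterMeasure_of_expect_le {p : PMF α} {E : Set α} {f : α → ℝ} {ε : ℝ}
    (hf : ∀ x, 0 ≤ f x) (hE : ∀ x ∈ p.support, f x ≤ 1 → x ∈ E) (hε : expect p f ≤ ε) :
    ENNReal.ofReal (1 - ε) ≤ p.toOuterMeasure E := by
  classical
  have h1 : p.toOuterMeasure E = ENNReal.ofReal (expect p fun x => if x ∈ E then 1 else 0) := by
    rw [PMF.toOuterMeasure_apply, tsum_fintype, expect, ENNReal.ofReal_sum_of_nonneg fun x _ => by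
      positivity]
    refine Finset.sum_congr rfl fun x _ => ?_
    by_cases hx : x ∈ E
    · simp [hx, p.apply_ne_top x]
    · simp [hx]
  rw [h1]
  refine ENNReal.ofReal_le_ofReal ?_
  have h2 : expect p (fun x => 1 - f x) ≤ expect p fun x => if x ∈ E then 1 else 0 := by
    refine expect_mono fun x hx => ?_
    by_cases hfx : f x ≤ 1
    · simp [hE x hx hfx, hf x]
    · have : 1 - f x ≤ 0 := by linarith [not_le.1 hfx]
      split_ifs <;> linarith
  rw [expect_sub, expect_const] at h2
  linarith

end Expect

/-! ### Play of one episode -/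

namespace MarkovGame

variable {S A B : Type*} {H : ℕ} {G : MarkovGame S A B H} {μ : Policy S A} {ν : Policy S B}

/-- Along a play between legal policies, every state and action belongs to its layer. -/
theorem mem_of_mem_support_rollout (hμ : G.IsLearnerPolicy μ) (hν : G.IsOppPolicy ν) :
    ∀ (n h : ℕ) (s : S), h + n ≤ H → s ∈ G.states h → ∀ t ∈ (G.rollout μ ν n h s).support,
      ∀ i : Fin n, (t i).1 ∈ G.states (h + i) ∧ (t i).2.1 ∈ G.actions (h + i) ∧
        (t i).2.2 ∈ G.oppActions (h + i)
  | 0, _, _, _, _, _, _ => fun i => i.elim0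
  | n + 1, h, s, hn, hs, t, ht => by
    simp only [rollout, PMF.mem_support_bind_iff, PMF.mem_support_map_iff] at ht
    obtain ⟨a, ha, b, hb, s', hs', t', ht', rfl⟩ := ht
    have ha := hμ h (by omega) s hs ha
    have hb := hν h (by omega) s hs hb
    have hs'' := G.transition_support h (by omega) s hs a ha b hb hs'
    intro i
    refine Fin.cases ?_ (fun j => ?_) i
    · simpa using ⟨hs, ha, hb⟩
    · have := mem_of_mem_support_rollout hμ hν n (h + 1) s' (by omega) hs'' t' ht' j
      simpa [add_assoc, add_comm 1] using this

variable [Fintype S] [Fintype A] [Fintype B]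

theorem expect_rollout_succ (n h : ℕ) (s : S) (f : (Fin (n + 1) → S × A × B) → ℝ) :
    expect (G.rollout μ ν (n + 1) h s) f =
      expect (μ h s) fun a => expect (ν h s) fun b => expect (G.transition h s a b) fun s' =>
        expect (G.rollout μ ν n (h + 1) s') fun t =>
          f (Fin.cons (α := fun _ : Fin (n + 1) => S × A × B) (s, a, b) t) := by
  simp only [rollout, expect_bind, expect_map]

/-- The Markov property: to bound the mean of a function of the state, the two actions and (a
function `V` of) the next state at one step of an episode, it suffices to bound its mean over one
step of play from every state of that layer. After the last step, `V` is replaced by `0`. -/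
theorem expect_rollout_le (hμ : G.IsLearnerPolicy μ) (hν : G.IsOppPolicy ν)
    (F : S → A → B → ℝ → ℝ) (V : S → ℝ) (c : ℝ) :
    ∀ (i n h : ℕ) (hi : i < n) (s : S), h + n ≤ H → s ∈ G.states h →
      (∀ s ∈ G.states (h + i), expect (μ (h + i) s) (fun a => expect (ν (h + i) s) fun b =>
        expect (G.transition (h + i) s a b) fun s' =>
          F s a b (if i + 1 < n then V s' else 0)) ≤ c) →
      expect (G.rollout μ ν n h s) (fun t => F (t ⟨i, hi⟩).1 (t ⟨i, hi⟩).2.1 (t ⟨i, hi⟩).2.2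
        (if hn : i + 1 < n then V (t ⟨i + 1, hn⟩).1 else 0)) ≤ c
  | 0, n + 1, h, _, s, hn, hs, hc => by
    refine le_trans (le_of_eq ?_) (hc s hs)
    rw [expect_rollout_succ]
    congr! 6 with a b s'
    cases n with
    | zero => simp [expect_const]
    | succ n =>
      rw [expect_rollout_succ]
      simp only [Fin.zero_eta, Fin.cons_zero, zero_add, Nat.lt_add_left_iff_pos,
        Nat.zero_lt_succ, ↓reduceDIte, ↓reduceIte]
      have : (⟨1, by omega⟩ : Fin (n + 2)) = Fin.succ 0 := rfl
      simp only [this, Fin.cons_succ, Fin.cons_zero, expect_const]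
  | i + 1, n + 1, h, hi, s, hn, hs, hc => by
    rw [expect_rollout_succ]
    refine expect_le fun a ha => expect_le fun b hb => expect_le fun s' hs' => ?_
    have ha := hμ h (by omega) s hs ha
    have hb := hν h (by omega) s hs hb
    have hs'' := G.transition_support h (by omega) s hs a ha b hb hs'
    have hi' : i < n := by omega
    have := expect_rollout_le hμ hν F V c i n (h + 1) hi' s' (by omega) hs'' (by
      rw [add_assoc, add_comm 1 i]
      simpa using hc)
    refine le_trans (le_of_eq ?_) this
    congr! 2 with t
    have e1 : (⟨i + 1, hi⟩ : Fin (n + 1)) = Fin.succ ⟨i, hi'⟩ := rfl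
    rw [e1, Fin.cons_succ]
    by_cases h2 : i + 1 < n
    · have e2 : (⟨i + 1 + 1, by omega⟩ : Fin (n + 1)) = Fin.succ ⟨i + 1, h2⟩ := rfl
      simp only [Nat.add_lt_add_iff_right, h2, ↓reduceDIte, e2, Fin.cons_succ]
    · simp [h2]

/-- Bellman's equation for the value of a pair of policies. -/
theorem value_eq {h : ℕ} (hh : h < H) (s : S) :
    G.value μ ν h s = expect (μ h s) fun a => expect (ν h s) fun b =>
      G.reward h s a b + G.expectNext h (G.value μ ν (h + 1)) s a b := by
  obtain ⟨n, hn⟩ : ∃ n, H - h = n + 1 := ⟨H - h - 1, by omega⟩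
  have hn' : H - (h + 1) = n := by omega
  have h1 : ∀ (m : ℕ) (h : ℕ) (s : S), H - h = m → G.value μ ν h s =
      expect (G.rollout μ ν m h s) fun t =>
        ∑ i : Fin m, G.reward (h + i) (t i).1 (t i).2.1 (t i).2.2 := by
    rintro m h s rfl
    rfl
  rw [h1 _ _ _ hn, expect_rollout_succ]
  congr! 4 with a b
  have h2 : G.expectNext h (G.value μ ν (h + 1)) s a b =
      expect (G.transition h s a b) (G.value μ ν (h + 1)) := rfl
  rw [h2]
  simp only [Fin.sum_univ_succ, Fin.cons_zero, Fin.cons_succ, expect_add, expect_const]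
  simp only [Fin.val_zero, add_zero, add_right_inj]
  congr! 2 with s'
  rw [h1 _ _ _ hn']
  simp only [Fin.val_succ, add_assoc, add_comm 1]

theorem value_terminal (s : S) : G.value μ ν H s = 0 := by
  unfold value
  refine Finset.sum_eq_zero fun t _ => ?_
  rw [Finset.sum_eq_zero (fun i _ => absurd i.2 (by simp)), mul_zero]

end MarkovGame

/-! ### Optimal values against a fixed opponent -/

namespace MarkovGame

variable {S A B : Type*} {H : ℕ} [Fintype S] [Fintype B]

/-- The mean of reward plus `V` of the next state when the learner plays `a` at `(h, s)` and the
opponent follows `ν`. -/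
def qVal (G : MarkovGame S A B H) (ν : Policy S B) (h : ℕ) (V : S → ℝ) (s : S) (a : A) : ℝ :=
  expect (ν h s) fun b => G.reward h s a b + expect (G.transition h s a b) V

/-- The optimal value of the Markov decision process that the learner faces when the opponent
follows `ν`, with `n` steps to go from step `h`. -/
def optVal (G : MarkovGame S A B H) (ν : Policy S B) : ℕ → ℕ → S → ℝ
  | 0, _, _ => 0
  | n + 1, h, s => (G.actions h).sup' (G.actions_nonempty h)
      fun a => G.qVal ν h (optVal G ν n (h + 1)) s a

/-- The optimal value from step `h` to the end of the episode. -/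
def optValue (G : MarkovGame S A B H) (ν : Policy S B) (h : ℕ) (s : S) : ℝ :=
  G.optVal ν (H - h) h s

variable {G : MarkovGame S A B H} {μ : Policy S A} {ν : Policy S B}

theorem optValue_terminal (s : S) : G.optValue ν H s = 0 := by
  simp [optValue, optVal]

theorem optValue_eq {h : ℕ} (hh : h < H) (s : S) :
    G.optValue ν h s = (G.actions h).sup' (G.actions_nonempty h)
      fun a => G.qVal ν h (G.optValue ν (h + 1)) s a := by
  obtain ⟨n, hn⟩ : ∃ n, H - h = n + 1 := ⟨H - h - 1, by omega⟩
  have hn' : H - (h + 1) = n := by omega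
  have e : G.optValue ν (h + 1) = G.optVal ν n (h + 1) := by
    funext s
    rw [optValue, hn']
  rw [e, optValue, hn, optVal]

theorem exists_optAction (G : MarkovGame S A B H) (ν : Policy S B) (h : ℕ) (s : S) :
    ∃ a ∈ G.actions h, (G.actions h).sup' (G.actions_nonempty h)
      (fun a => G.qVal ν h (G.optValue ν (h + 1)) s a) =
        G.qVal ν h (G.optValue ν (h + 1)) s a :=
  Finset.exists_mem_eq_sup' _ _

/-- An optimal action at `(h, s)` against `ν`. -/
def optAction (G : MarkovGame S A B H) (ν : Policy S B) (h : ℕ) (s : S) : A :=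
  (exists_optAction G ν h s).choose

theorem optAction_mem (G : MarkovGame S A B H) (ν : Policy S B) (h : ℕ) (s : S) :
    G.optAction ν h s ∈ G.actions h :=
  (exists_optAction G ν h s).choose_spec.1

theorem optValue_eq_qVal {h : ℕ} (hh : h < H) (s : S) :
    G.optValue ν h s = G.qVal ν h (G.optValue ν (h + 1)) s (G.optAction ν h s) := by
  rw [optValue_eq hh]
  exact (exists_optAction G ν h s).choose_spec.2

theorem qVal_mono (hν : G.IsOppPolicy ν) {h : ℕ} (hh : h < H) {V W : S → ℝ}
    (hVW : ∀ s ∈ G.states (h + 1), V s ≤ W s) {s : S} (hs : s ∈ G.states h) {a : A}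
    (ha : a ∈ G.actions h) : G.qVal ν h V s a ≤ G.qVal ν h W s a := by
  refine expect_mono fun b hb => add_le_add le_rfl (expect_mono fun s' hs' => hVW s' ?_)
  exact G.transition_support h hh s hs a ha b (hν h hh s hs hb) hs'

theorem qVal_mem (hν : G.IsOppPolicy ν) {h : ℕ} (hh : h < H) {V : S → ℝ} {c : ℝ}
    (hV : ∀ s ∈ G.states (h + 1), V s ∈ Set.Icc 0 c) {s : S} (hs : s ∈ G.states h) {a : A}
    (ha : a ∈ G.actions h) : G.qVal ν h V s a ∈ Set.Icc 0 (c + 1) := by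
  have key : ∀ b ∈ (ν h s).support,
      G.reward h s a b + expect (G.transition h s a b) V ∈ Set.Icc 0 (c + 1) := by
    intro b hb
    have hb := hν h hh s hs hb
    have hr := G.reward_mem h hh s hs a ha b hb
    have hs' := G.transition_support h hh s hs a ha b hb
    have h1 : 0 ≤ expect (G.transition h s a b) V := le_expect fun s' h' => (hV s' (hs' h')).1
    have h2 : expect (G.transition h s a b) V ≤ c := expect_le fun s' h' => (hV s' (hs' h')).2
    exact ⟨by linarith [hr.1], by linarith [hr.2]⟩
  exact ⟨le_expect fun b hb => (key b hb).1, expect_le fun b hb => (key b hb).2⟩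

theorem optValue_mem (hν : G.IsOppPolicy ν) :
    ∀ (n h : ℕ), h + n = H → ∀ s ∈ G.states h, G.optValue ν h s ∈ Set.Icc 0 (n : ℝ)
  | 0, h, hn, s, _ => by
    obtain rfl : h = H := by omega
    simp [optValue_terminal]
  | n + 1, h, hn, s, hs => by
    rw [optValue_eq_qVal (by omega)]
    push_cast
    exact qVal_mem hν (by omega) (optValue_mem hν n (h + 1) (by omega)) hs
      (optAction_mem G ν h s)

theorem optValue_le (hν : G.IsOppPolicy ν) {h : ℕ} (hh : h < H) {s : S} (hs : s ∈ G.states h) :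
    G.optValue ν h s ≤ H - h := by
  have := (optValue_mem hν (H - h) h (by omega) s hs).2
  rwa [Nat.cast_sub hh.le] at this

theorem isLearnerPolicy_optAction (G : MarkovGame S A B H) (ν : Policy S B) :
    G.IsLearnerPolicy fun h s => PMF.pure (G.optAction ν h s) := by
  intro h _ s _ a ha
  rw [PMF.mem_support_pure_iff] at ha
  exact ha ▸ optAction_mem G ν h s

variable [Fintype A]

theorem value_eq_expect_qVal {h : ℕ} (hh : h < H) (s : S) :
    G.value μ ν h s = expect (μ h s) (G.qVal ν h (G.value μ ν (h + 1)) s) :=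
  value_eq hh s

theorem value_mem (hμ : G.IsLearnerPolicy μ) (hν : G.IsOppPolicy ν) :
    ∀ (n h : ℕ), h + n = H → ∀ s ∈ G.states h, G.value μ ν h s ∈ Set.Icc 0 (n : ℝ)
  | 0, h, hn, s, _ => by
    obtain rfl : h = H := by omega
    simp [value_terminal]
  | n + 1, h, hn, s, hs => by
    rw [value_eq_expect_qVal (by omega)]
    push_cast
    have key := fun a ha => qVal_mem hν (by omega : h < H)
      (value_mem hμ hν n (h + 1) (by omega)) hs (hμ h (by omega) s hs ha : a ∈ _)
    exact ⟨le_expect fun a ha => (key a ha).1, expect_le fun a ha => (key a ha).2⟩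

theorem value_le_optValue (hμ : G.IsLearnerPolicy μ) (hν : G.IsOppPolicy ν) :
    ∀ (n h : ℕ), h + n = H → ∀ s ∈ G.states h, G.value μ ν h s ≤ G.optValue ν h s
  | 0, h, hn, s, _ => by
    obtain rfl : h = H := by omega
    simp [value_terminal, optValue_terminal]
  | n + 1, h, hn, s, hs => by
    rw [value_eq_expect_qVal (by omega), optValue_eq (by omega)]
    refine expect_le fun a ha => ?_
    have ha := hμ h (by omega) s hs ha
    exact (qVal_mono hν (by omega) (value_le_optValue hμ hν n (h + 1) (by omega)) hs ha).trans
      (Finset.le_sup' (fun a => G.qVal ν h (G.optValue ν (h + 1)) s a) ha)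

/-- The deterministic policy of optimal actions attains the optimal value. -/
theorem value_optAction : ∀ (n h : ℕ), h + n = H → ∀ s,
    G.value (fun h s => PMF.pure (G.optAction ν h s)) ν h s = G.optValue ν h s
  | 0, h, hn, s => by
    obtain rfl : h = H := by omega
    simp [value_terminal, optValue_terminal]
  | n + 1, h, hn, s => by
    rw [value_eq_expect_qVal (by omega), optValue_eq_qVal (by omega), expect_pure,
      funext (value_optAction n (h + 1) (by omega))]

theorem mixedMean_eq_expect (p : PMF A) (q : PMF B) (Q : A → B → ℝ) :
    mixedMean p q Q = expect p fun a => expect q (Q a) := by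
  simp only [mixedMean, expect, Finset.mul_sum, mul_assoc]

/-- Against a fixed opponent the empirical Nash value is the optimal value of the induced Markov
decision process: the minimum is over one distribution. -/
theorem empNashAux_const {K : ℕ} [NeZero K] (ν : Policy S B) : ∀ (n h : ℕ) (s : S),
    G.empNashAux (fun _ : Fin K => ν) n h s = G.optVal ν n h s
  | 0, _, _ => rfl
  | n + 1, h, s => by
    rw [empNashAux, funext (empNashAux_const ν n (h + 1)), optVal]
    simp only [ciInf_const, mixedMean_eq_expect]
    have hle : ∀ p : {p : PMF A // p.support ⊆ (G.actions h : Set A)},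
        expect p.1 (fun a => G.qVal ν h (G.optVal ν n (h + 1)) s a) ≤
          (G.actions h).sup' (G.actions_nonempty h)
            fun a => G.qVal ν h (G.optVal ν n (h + 1)) s a := fun p =>
      expect_le fun a ha => Finset.le_sup' (fun a => G.qVal ν h (G.optVal ν n (h + 1)) s a) (p.2 ha)
    obtain ⟨a, ha, hmax⟩ := Finset.exists_mem_eq_sup' (G.actions_nonempty h)
      fun a => G.qVal ν h (G.optVal ν n (h + 1)) s a
    have hsupp : (PMF.pure a).support ⊆ (G.actions h : Set A) := by
      intro a' ha'
      rw [PMF.mem_support_pure_iff] at ha'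
      exact ha' ▸ ha
    have : Nonempty {p : PMF A // p.support ⊆ (G.actions h : Set A)} := ⟨⟨_, hsupp⟩⟩
    refine le_antisymm (ciSup_le hle) ?_
    rw [hmax]
    refine le_trans (expect_pure a _).ge
      (le_ciSup (f := fun p : {p : PMF A // p.support ⊆ (G.actions h : Set A)} =>
        expect p.1 (fun a => G.qVal ν h (G.optVal ν n (h + 1)) s a)) ⟨_, Set.forall_mem_range.2 hle⟩
        ⟨_, hsupp⟩)

theorem empNash_const {K : ℕ} [NeZero K] (ν : Policy S B) (h : ℕ) (s : S) :
    G.empNash (fun _ : Fin K => ν) h s = G.optValue ν h s :=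
  empNashAux_const ν _ h s

/-- Against a fixed opponent, external regret and empirical Nash-value regret agree: one policy
of the learner is optimal from all initial states at once. -/
theorem externalRegret_const {K : ℕ} [NeZero K] (hν : G.IsOppPolicy ν) (s₁ : Fin K → S)
    (hs₁ : ∀ k, s₁ k ∈ G.states 0) (μ : Fin K → Policy S A) :
    G.externalRegret s₁ μ (fun _ => ν) = G.empNashRegret s₁ μ (fun _ => ν) := by
  unfold externalRegret empNashRegret
  simp only [empNash_const]
  have hle : ∀ μ' : {μ' : Policy S A // G.IsLearnerPolicy μ'},
      ∑ k, (G.value μ'.1 ν 0 (s₁ k) - G.value (μ k) ν 0 (s₁ k)) ≤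
        ∑ k, (G.optValue ν 0 (s₁ k) - G.value (μ k) ν 0 (s₁ k)) := fun μ' =>
    Finset.sum_le_sum fun k _ =>
      sub_le_sub_right (value_le_optValue μ'.2 hν H 0 (by omega) _ (hs₁ k)) _
  have : Nonempty {μ' : Policy S A // G.IsLearnerPolicy μ'} := ⟨⟨_, isLearnerPolicy_optAction G ν⟩⟩
  refine le_antisymm (ciSup_le hle) ?_
  refine le_trans (le_of_eq ?_)
    (le_ciSup (f := fun μ' : {μ' : Policy S A // G.IsLearnerPolicy μ'} =>
      ∑ k, (G.value μ'.1 ν 0 (s₁ k) - G.value (μ k) ν 0 (s₁ k))) ⟨_, Set.forall_mem_range.2 hle⟩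
      ⟨_, isLearnerPolicy_optAction G ν⟩)
  exact Finset.sum_congr rfl fun k _ => by simp only [value_optAction H 0 (Nat.zero_add H)]

end MarkovGame

/-! ### Follow-the-regularized-leader with the `1/2`-Tsallis entropy -/

section Ftrl

variable {A : Type*} [Fintype A] {X : Finset A} {hX : X.Nonempty} {lr : ℝ} {L : A → ℝ}

theorem ftrlObjective_ftrlPoint_le {q : A → ℝ} (hq : q ∈ simplexOn X) :
    ftrlObjective lr L (ftrlPoint X hX lr L) ≤ ftrlObjective lr L q :=
  (exists_ftrl X hX lr L).choose_spec.2 hq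

theorem single_mem_simplexOn [DecidableEq A] {a : A} (ha : a ∈ X) :
    (Pi.single a 1 : A → ℝ) ∈ simplexOn X := by
  refine ⟨fun b => ?_, fun b hb => ?_, by simp⟩
  · by_cases hb : b = a
    · subst hb; simp
    · simp [hb]
  · have hne : b ≠ a := fun h => hb (h ▸ ha)
    simp [hne]

theorem convexComb_mem_simplexOn {p q : A → ℝ} (hp : p ∈ simplexOn X) (hq : q ∈ simplexOn X)
    {ε : ℝ} (h0 : 0 ≤ ε) (h1 : ε ≤ 1) : (fun a => (1 - ε) * p a + ε * q a) ∈ simplexOn X := by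
  refine ⟨fun a => ?_, fun a ha => ?_, ?_⟩
  · have := hp.1 a
    have := hq.1 a
    have : 0 ≤ 1 - ε := by linarith
    positivity
  · simp [hp.2.1 a ha, hq.2.1 a ha]
  · rw [Finset.sum_add_distrib, ← Finset.mul_sum, ← Finset.mul_sum, hp.2.2, hq.2.2]
    ring

/-- The minimum of the objective is at most the cumulative loss of any fixed action. -/
theorem ftrlObjective_le_loss [DecidableEq A] {a : A} (ha : a ∈ X) :
    ftrlObjective lr L (ftrlPoint X hX lr L) ≤ L a := by
  refine (ftrlObjective_ftrlPoint_le (single_mem_simplexOn ha)).trans (le_of_eq ?_)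
  have h1 : ∑ b, √((Pi.single a 1 : A → ℝ) b) = 1 := by
    rw [Finset.sum_eq_single a] <;> simp +contextual
  have h2 : ∑ b, (Pi.single a 1 : A → ℝ) b * L b = L a := by
    rw [Finset.sum_eq_single a] <;> simp +contextual
  rw [ftrlObjective, tsallisHalf, h1, h2]
  simp

theorem sum_sqrt_le {p : A → ℝ} (hp : p ∈ simplexOn X) : ∑ a, √(p a) ≤ √X.card := by
  have h1 : ∑ a, √(p a) = ∑ a ∈ X, √(p a) := by
    symm
    refine Finset.sum_subset (Finset.subset_univ X) fun a _ ha => ?_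
    rw [hp.2.1 a ha, Real.sqrt_zero]
  have h2 : ∑ a ∈ X, p a = 1 := by
    rw [← hp.2.2]
    exact Finset.sum_subset (Finset.subset_univ X) fun a _ ha => hp.2.1 a ha
  rw [h1]
  refine Real.le_sqrt_of_sq_le ?_
  refine sq_sum_le_card_mul_sum_sq.trans (le_of_eq ?_)
  rw [Finset.sum_congr rfl fun a _ => Real.sq_sqrt (hp.1 a), h2, mul_one]

theorem neg_ftrlObjective_zero_le (hlr : 0 < lr) :
    -ftrlObjective lr 0 (ftrlPoint X hX lr 0) ≤ 2 * √X.card / lr := by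
  have := sum_sqrt_le (ftrlPoint_mem X hX lr 0)
  rw [ftrlObjective, tsallisHalf, neg_le_iff_add_nonneg]
  simp only [Pi.zero_apply, mul_zero, Finset.sum_const_zero, zero_add, ← add_div]
  refine div_nonneg ?_ hlr.le
  linarith [show (1 - ∑ a, √(ftrlPoint X hX lr 0 a)) / (1 - 1 / 2) =
    2 - 2 * ∑ a, √(ftrlPoint X hX lr 0 a) by ring]

/-- Comparison of the objective at the minimizer with its value on a segment leaving it. -/
theorem sum_sqrt_sub_le {q : A → ℝ} (hq : q ∈ simplexOn X) (hlr : 0 < lr) {ε : ℝ} (h0 : 0 ≤ ε)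
    (h1 : ε ≤ 1) :
    2 * ∑ a, (√((1 - ε) * ftrlPoint X hX lr L a + ε * q a) - √(ftrlPoint X hX lr L a)) ≤
      lr * ε * ∑ a, (q a - ftrlPoint X hX lr L a) * L a := by
  set p := ftrlPoint X hX lr L with hp
  have h := ftrlObjective_ftrlPoint_le (hX := hX) (lr := lr) (L := L)
    (convexComb_mem_simplexOn (ftrlPoint_mem X hX lr L) hq h0 h1)
  rw [← hp] at h
  unfold ftrlObjective tsallisHalf at h
  have e1 : ∑ a, ((1 - ε) * p a + ε * q a) * L a =
      ∑ a, p a * L a + ε * ∑ a, (q a - p a) * L a := by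
    rw [Finset.mul_sum, ← Finset.sum_add_distrib]
    exact Finset.sum_congr rfl fun a _ => by ring
  rw [e1] at h
  have h2 : (1 - ∑ a, √(p a)) / (1 - 1 / 2) / lr -
      (1 - ∑ a, √((1 - ε) * p a + ε * q a)) / (1 - 1 / 2) / lr ≤
        ε * ∑ a, (q a - p a) * L a := by linarith
  have e2 : ∀ x : ℝ, x / (1 - 1 / 2) = 2 * x := fun x => by ring
  rw [← sub_div, div_le_iff₀ hlr, e2, e2] at h2
  rw [Finset.sum_sub_distrib]
  linarith

/-- The minimizer is positive on `X`, because the square root has infinite slope at `0`. -/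
theorem ftrlPoint_pos (hlr : 0 < lr) {a : A} (ha : a ∈ X) : 0 < ftrlPoint X hX lr L a := by
  classical
  set p := ftrlPoint X hX lr L with hp
  have hpm : p ∈ simplexOn X := ftrlPoint_mem X hX lr L
  refine lt_of_le_of_ne (hpm.1 a) fun h0 => ?_
  set D := ∑ b, ((Pi.single a 1 : A → ℝ) b - p b) * L b with hD
  set C := |lr * D| + 2 * ∑ b, √(p b) + 1 with hC
  have hs : 0 ≤ ∑ b, √(p b) := Finset.sum_nonneg fun b _ => Real.sqrt_nonneg _
  have hC1 : 1 ≤ C := by linarith [abs_nonneg (lr * D)]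
  have key : ∀ ε : ℝ, 0 ≤ ε → ε ≤ 1 → 2 * √ε ≤ C * ε := by
    intro ε hε0 hε1
    have h := sum_sqrt_sub_le (hX := hX) (L := L) (single_mem_simplexOn ha) hlr hε0 hε1
    rw [← hp, ← hD] at h
    have h3 : ∀ b, (if b = a then √ε else 0) - ε * √(p b) ≤
        √((1 - ε) * p b + ε * (Pi.single a 1 : A → ℝ) b) - √(p b) := by
      intro b
      by_cases hb : b = a
      · subst hb
        simp [← h0]
      · have h4 : (1 - ε) * √(p b) ≤ √((1 - ε) * p b) := by
          rw [Real.sqrt_mul (by linarith)]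
          refine mul_le_mul_of_nonneg_right ?_ (Real.sqrt_nonneg _)
          exact Real.le_sqrt_of_sq_le (by nlinarith)
        simp only [hb, if_false, Pi.single_apply, mul_zero, add_zero]
        linarith
    have h5 := Finset.sum_le_sum fun b (_ : b ∈ Finset.univ) => h3 b
    rw [Finset.sum_sub_distrib, Finset.sum_ite_eq' Finset.univ a, ← Finset.mul_sum] at h5
    simp only [Finset.mem_univ, if_true] at h5
    have h6 : lr * ε * D ≤ |lr * D| * ε := by
      have := mul_le_mul_of_nonneg_right (le_abs_self (lr * D)) hε0
      linarith
    rw [hC]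
    nlinarith
  have h7 := key (1 / C ^ 2) (by positivity) (by
    rw [div_le_one (by positivity)]
    nlinarith)
  rw [Real.sqrt_div zero_le_one, Real.sqrt_one, Real.sqrt_sq (by linarith)] at h7
  have h8 : C * (1 / C ^ 2) = 1 / C := by
    field_simp
  rw [h8] at h7
  have : 0 < 1 / C := by positivity
  linarith

theorem sqrt_add_ge {p x : ℝ} (hp : 0 < p) (hx : 0 ≤ p + x) :
    x / √p - x ^ 2 / (p * √p) ≤ 2 * (√(p + x) - √p) := by
  have hu : 0 < √p := Real.sqrt_pos.2 hp
  have hv := Real.sqrt_nonneg (p + x)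
  have hu2 := Real.sq_sqrt hp.le
  have hv2 := Real.sq_sqrt hx
  set u := √p
  set v := √(p + x)
  have hx' : x = v ^ 2 - u ^ 2 := by linarith
  rw [hx', ← hu2, div_sub_div _ _ hu.ne' (by positivity), div_le_iff₀ (by positivity)]
  have : 0 ≤ u * (v - u) ^ 2 * ((v + u) ^ 2 - u ^ 2) := by
    have : 0 ≤ (v + u) ^ 2 - u ^ 2 := by nlinarith
    positivity
  nlinarith

/-- First-order optimality of the minimizer. -/
theorem ftrl_firstOrder (hlr : 0 < lr) {q : A → ℝ} (hq : q ∈ simplexOn X) :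
    ∑ a, (q a - ftrlPoint X hX lr L a) / √(ftrlPoint X hX lr L a) ≤
      lr * ∑ a, (q a - ftrlPoint X hX lr L a) * L a := by
  set p := ftrlPoint X hX lr L with hp
  have hpm : p ∈ simplexOn X := ftrlPoint_mem X hX lr L
  set C := ∑ a, (q a - p a) ^ 2 / (p a * √(p a)) with hC
  have key : ∀ ε : ℝ, 0 < ε → ε ≤ 1 →
      ∑ a, (q a - p a) / √(p a) - ε * C ≤ lr * ∑ a, (q a - p a) * L a := by
    intro ε hε0 hε1
    have h := sum_sqrt_sub_le (hX := hX) (L := L) hq hlr hε0.le hε1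
    rw [← hp] at h
    have h3 : ∀ a, ε * ((q a - p a) / √(p a) - ε * ((q a - p a) ^ 2 / (p a * √(p a)))) ≤
        2 * (√((1 - ε) * p a + ε * q a) - √(p a)) := by
      intro a
      by_cases ha : a ∈ X
      · have hpa : 0 < p a := ftrlPoint_pos hlr ha
        have := sqrt_add_ge (x := ε * (q a - p a)) hpa (by
          have h1 := hq.1 a
          have h2 : 0 ≤ 1 - ε := by linarith
          have : 0 ≤ (1 - ε) * p a + ε * q a := by positivity
          linarith)
        have e : p a + ε * (q a - p a) = (1 - ε) * p a + ε * q a := by ring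
        rw [e] at this
        refine le_trans (le_of_eq ?_) this
        ring
      · simp [hpm.2.1 a ha, hq.2.1 a ha]
    have h5 := Finset.sum_le_sum fun a (_ : a ∈ Finset.univ) => h3 a
    rw [← Finset.mul_sum, ← Finset.mul_sum, Finset.sum_sub_distrib, ← Finset.mul_sum, ← hC] at h5
    have h6 := h5.trans h
    have h7 : ε * (∑ a, (q a - p a) / √(p a) - ε * C) ≤
        ε * (lr * ∑ a, (q a - p a) * L a) := by linarith
    exact le_of_mul_le_mul_left h7 hε0
  have hC0 : 0 ≤ C := Finset.sum_nonneg fun a _ =>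
    div_nonneg (sq_nonneg _) (mul_nonneg (hpm.1 a) (Real.sqrt_nonneg _))
  refine le_of_forall_pos_le_add fun ε hε => ?_
  have hm : 0 < min 1 (ε / (C + 1)) := by positivity
  have h1 := key _ hm (min_le_left _ _)
  have h2 : min 1 (ε / (C + 1)) * C ≤ ε := by
    calc min 1 (ε / (C + 1)) * C ≤ ε / (C + 1) * (C + 1) := by
          gcongr
          · exact min_le_right _ _
          · linarith
      _ = ε := by field_simp
  linarith

/-- Stability of follow-the-regularized-leader: when the loss of one action grows by `y`, the
minimum of the objective grows by at least `p(a) y` up to a second-order term. -/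
theorem ftrl_stability [DecidableEq A] (hlr : 0 < lr) {a : A} (ha : a ∈ X) {y : ℝ} (hy : 0 ≤ y) :
    ftrlObjective lr L (ftrlPoint X hX lr L) + ftrlPoint X hX lr L a * y -
        lr * √(ftrlPoint X hX lr L a) * (ftrlPoint X hX lr L a * y ^ 2) ≤
      ftrlObjective lr (Function.update L a (L a + y))
        (ftrlPoint X hX lr (Function.update L a (L a + y))) := by
  set q := ftrlPoint X hX lr (Function.update L a (L a + y)) with hqdef
  have hq : q ∈ simplexOn X := ftrlPoint_mem X hX lr _
  set p := ftrlPoint X hX lr L with hp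
  have hpm : p ∈ simplexOn X := ftrlPoint_mem X hX lr L
  have e1 : ∑ b, q b * Function.update L a (L a + y) b = ∑ b, q b * L b + q a * y := by
    have : ∀ b, q b * Function.update L a (L a + y) b =
        q b * L b + if b = a then q b * y else 0 := by
      intro b
      by_cases hb : b = a
      · subst hb
        simp [mul_add]
      · simp [hb]
    rw [Finset.sum_congr rfl fun b _ => this b, Finset.sum_add_distrib, Finset.sum_ite_eq']
    simp
  have hfo := ftrl_firstOrder (hX := hX) (L := L) hlr hq
  rw [← hp] at hfo
  -- the Bregman divergence of `q` from `p`, term by term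
  have hbreg : ∀ b, √(p b) * ((√(q b) - √(p b)) ^ 2 / p b) =
      (q b - p b) / √(p b) - 2 * (√(q b) - √(p b)) := by
    intro b
    by_cases hb : b ∈ X
    · have hpb : 0 < p b := ftrlPoint_pos hlr hb
      have hu : 0 < √(p b) := Real.sqrt_pos.2 hpb
      have hu2 := Real.sq_sqrt hpb.le
      have hv2 := Real.sq_sqrt (hq.1 b)
      set u := √(p b)
      set v := √(q b)
      rw [← hu2, ← hv2]
      field_simp
      ring
    · simp [hpm.2.1 b hb, hq.2.1 b hb]
  have hge : √(p a) * ((√(q a) - √(p a)) ^ 2 / p a) ≤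
      ∑ b, ((q b - p b) / √(p b) - 2 * (√(q b) - √(p b))) := by
    refine Finset.single_le_sum (f := fun b => (q b - p b) / √(p b) - 2 * (√(q b) - √(p b)))
      (fun b _ => ?_) (Finset.mem_univ a) |> le_trans (hbreg a).le
    rw [← hbreg b]
    exact mul_nonneg (Real.sqrt_nonneg _) (div_nonneg (sq_nonneg _) (hpm.1 b))
  rw [Finset.sum_sub_distrib, ← Finset.mul_sum, Finset.sum_sub_distrib] at hge
  have hpa : 0 < p a := ftrlPoint_pos hlr ha
  have hu : 0 < √(p a) := Real.sqrt_pos.2 hpa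
  have hv := Real.sqrt_nonneg (q a)
  have hu2 := Real.sq_sqrt hpa.le
  have hv2 := Real.sq_sqrt (hq.1 a)
  have hsplit : ∑ b, (q b - p b) * L b = ∑ b, q b * L b - ∑ b, p b * L b := by
    rw [← Finset.sum_sub_distrib]
    exact Finset.sum_congr rfl fun b _ => by ring
  rw [hsplit] at hfo
  unfold ftrlObjective tsallisHalf
  rw [e1]
  have hmain : √(p a) * ((√(q a) - √(p a)) ^ 2 / p a) + lr * ((q a - p a) * y) +
      lr * (lr * √(p a) * (p a * y ^ 2)) ≥ 0 := by
    set u := √(p a)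
    set v := √(q a)
    rw [← hu2, ← hv2]
    have e : u * ((v - u) ^ 2 / u ^ 2) = (v - u) ^ 2 / u := by
      field_simp
    rw [e]
    by_cases hvu : u ≤ v
    · have : 0 ≤ (v ^ 2 - u ^ 2) * y := mul_nonneg (by nlinarith) hy
      positivity
    · have h1 : -(2 * u * (u - v) * y) ≤ (v ^ 2 - u ^ 2) * y := by
        have : 0 ≤ (u - v) ^ 2 * y := by positivity
        nlinarith
      have h2 : 0 ≤ (((u - v) - lr * u ^ 2 * y) ^ 2) / u := by positivity
      have h3 : (((u - v) - lr * u ^ 2 * y) ^ 2) / u =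
          (v - u) ^ 2 / u - lr * (2 * u * (u - v) * y) + lr * (lr * u * (u ^ 2 * y ^ 2)) := by
        field_simp
        ring
      nlinarith
  have hfin : 0 ≤ (lr * (∑ b, q b * L b - ∑ b, p b * L b) -
      2 * (∑ b, √(q b) - ∑ b, √(p b)) + lr * ((q a - p a) * y) +
      lr * (lr * √(p a) * (p a * y ^ 2))) / lr := by
    refine div_nonneg ?_ hlr.le
    linarith
  have hfe : (lr * (∑ b, q b * L b - ∑ b, p b * L b) -
      2 * (∑ b, √(q b) - ∑ b, √(p b)) + lr * ((q a - p a) * y) +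
      lr * (lr * √(p a) * (p a * y ^ 2))) / lr =
      ∑ b, q b * L b + q a * y + (1 - ∑ b, √(q b)) / (1 - 1 / 2) / lr -
      (∑ b, p b * L b + (1 - ∑ b, √(p b)) / (1 - 1 / 2) / lr + p a * y -
        lr * √(p a) * (p a * y ^ 2)) := by
    field_simp
    ring
  linarith

theorem ftrlPolicy_apply (a : A) :
    (ftrlPolicy X hX lr L a).toReal = ftrlPoint X hX lr L a := by
  rw [ftrlPolicy, PMF.ofFintype_apply, ENNReal.toReal_ofReal ((ftrlPoint_mem X hX lr L).1 a)]

theorem ftrlPolicy_support : (ftrlPolicy X hX lr L).support ⊆ (X : Set A) := by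
  intro a ha
  by_contra h
  rw [PMF.mem_support_iff, ftrlPolicy, PMF.ofFintype_apply,
    (ftrlPoint_mem X hX lr L).2.1 a h] at ha
  simp at ha

end Ftrl

/-! ### Regret of the bandit subroutine within a block -/

section Block

variable {A : Type*} {X : Finset A} {hX : X.Nonempty} {δ' : ℝ}

/-- The implicit-exploration parameter `γ` of a block of `2 ^ J` rounds. -/
def ixGamma (X : Finset A) (δ' : ℝ) (J : ℕ) : ℝ :=
  √(Real.log (X.card / δ') / (X.card * 2 ^ J))

/-- The learning rate of a block of `2 ^ J` rounds. -/
def ixRate (J : ℕ) : ℝ := 1 / √(2 ^ J)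

theorem ixRate_pos (J : ℕ) : 0 < ixRate J := by
  unfold ixRate
  positivity

theorem ixRate_le_one (J : ℕ) : ixRate J ≤ 1 := by
  unfold ixRate
  rw [div_le_one (by positivity)]
  exact Real.one_le_sqrt.2 (one_le_pow₀ (by norm_num))

theorem ixGamma_pos (hX : X.Nonempty) (hlg : 0 < Real.log (X.card / δ')) (J : ℕ) :
    0 < ixGamma X δ' J := by
  have : (0 : ℝ) < X.card := by exact_mod_cast hX.card_pos
  unfold ixGamma
  positivity

section Weights

variable [DecidableEq A]

/-- The weight of action `a` in the concentration argument. The three summands account for the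
estimated loss of the comparator `aStar`, for the exploration bias, and for the stability term of
follow-the-regularized-leader; for `γ ≤ 1` the cap by `1` is not active. -/
def ixWeight (X : Finset A) (δ' : ℝ) (aStar : A) (J : ℕ) (p : A → ℝ) (a : A) : ℝ :=
  2 * ixGamma X δ' J / 3 *
    ((if a = aStar then 1 else 0) + min (ixGamma X δ' J) 1 + ixRate J * √(p a))

theorem ixWeight_nonneg (aStar : A) (J : ℕ) (p : A → ℝ) (a : A) :
    0 ≤ ixWeight X δ' aStar J p a := by
  have h1 : 0 ≤ ixGamma X δ' J := Real.sqrt_nonneg _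
  have h2 := (ixRate_pos J).le
  have h3 : 0 ≤ min (ixGamma X δ' J) 1 := le_min h1 zero_le_one
  unfold ixWeight
  split_ifs <;> positivity

theorem ixWeight_le (aStar : A) (J : ℕ) {p : A → ℝ} {a : A} (hp : p a ≤ 1) :
    ixWeight X δ' aStar J p a ≤ 2 * ixGamma X δ' J := by
  have h1 : 0 ≤ ixGamma X δ' J := Real.sqrt_nonneg _
  have h2 := min_le_right (ixGamma X δ' J) 1
  have h3 : ixRate J * √(p a) ≤ 1 * 1 :=
    mul_le_mul (ixRate_le_one J) (Real.sqrt_le_one.2 hp) (Real.sqrt_nonneg _) zero_le_one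
  have h4 : (if a = aStar then (1 : ℝ) else 0) ≤ 1 := by split_ifs <;> norm_num
  calc ixWeight X δ' aStar J p a ≤ 2 * ixGamma X δ' J / 3 * (1 + 1 + 1) := by
        unfold ixWeight
        gcongr
        linarith
    _ = 2 * ixGamma X δ' J := by ring

end Weights

variable [Fintype A]

/-- An upper bound for the regret against `aStar` of `m` rounds of a block of `2 ^ J` rounds with
cumulative estimated losses `L` and accumulated weighted deviation `U`. Where the analysis of the
loss estimates gives nothing (`γ > 1`, or the first block, which is played uniformly), it is the
number of rounds. -/
def blockRegret (X : Finset A) (hX : X.Nonempty) (δ' : ℝ) (aStar : A) (J m : ℕ) (L : A → ℝ)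
    (U : ℝ) : ℝ :=
  if ixGamma X δ' J ≤ 1 ∧ 1 ≤ J then
    ftrlObjective (ixRate J) L (ftrlPoint X hX (ixRate J) L) - L aStar -
      ftrlObjective (ixRate J) 0 (ftrlPoint X hX (ixRate J) 0) +
      3 / (2 * ixGamma X δ' J) * U +
      m * (ixGamma X δ' J * X.card + ixRate J * √X.card)
  else m

theorem blockRegret_start (aStar : A) (J : ℕ) :
    blockRegret X hX δ' aStar J 0 0 0 = 0 := by
  simp [blockRegret]

variable [DecidableEq A]

/-- The weighted deviation of the implicit-exploration loss estimates from the mean losses `ℓ`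
in one round in which action `a` brought reward `x`. -/
def ixIncrement (X : Finset A) (δ' : ℝ) (aStar : A) (st : BanditState A) (ℓ : A → ℝ) (a : A)
    (x : ℝ) : ℝ :=
  ixWeight X δ' aStar st.block (fun a => (st.policy a).toReal) a *
      ((1 - x) / ((st.policy a).toReal + ixGamma X δ' st.block)) -
    ∑ a' ∈ X, ixWeight X δ' aStar st.block (fun a => (st.policy a).toReal) a' * ℓ a'

/-- One round adds at most the increment of `blockRegret` to the regret. -/
theorem blockRegret_step {aStar : A} (hStar : aStar ∈ X) (hlg : 0 < Real.log (X.card / δ'))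
    {st : BanditState A}
    (hst : 1 ≤ st.block → st.policy = ftrlPolicy X hX (ixRate st.block) st.loss)
    {m : ℕ} {U v x : ℝ} {a : A} (ha : a ∈ X) (hx : x ∈ Set.Icc (0 : ℝ) 1) (hv : v ≤ 1)
    {ℓ : A → ℝ} (hℓ : ∀ a ∈ X, ℓ a ∈ Set.Icc (0 : ℝ) 1) (hv' : ℓ aStar ≤ 1 - v) :
    blockRegret X hX δ' aStar st.block m st.loss U + (v - x) ≤
      blockRegret X hX δ' aStar st.block (m + 1) (Function.update st.loss a
        (st.loss a + (1 - x) / ((st.policy a).toReal + ixGamma X δ' st.block)))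
        (U + ixIncrement X δ' aStar st ℓ a x) := by
  have hγ : 0 < ixGamma X δ' st.block := ixGamma_pos hX hlg _
  by_cases hcase : ixGamma X δ' st.block ≤ 1 ∧ 1 ≤ st.block
  swap
  · simp only [blockRegret, hcase, if_false]
    push_cast
    linarith [hx.1]
  have hpol := hst hcase.2
  have hlr := ixRate_pos st.block
  simp only [blockRegret, hcase, and_self, if_true, ixIncrement, ixWeight, hpol, ftrlPolicy_apply,
    min_eq_left hcase.1]
  set γ := ixGamma X δ' st.block
  set lr := ixRate st.block
  set L := st.loss
  set p := ftrlPoint X hX lr L with hp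
  have hpm : p ∈ simplexOn X := ftrlPoint_mem X hX lr L
  set y := (1 - x) / (p a + γ) with hy
  have hpa : 0 ≤ p a := hpm.1 a
  have hpγ : 0 < p a + γ := by linarith
  have hy0 : 0 ≤ y := div_nonneg (by linarith [hx.2]) hpγ.le
  have hyp : y * (p a + γ) = 1 - x := div_mul_cancel₀ _ hpγ.ne'
  have hpy : p a * y ≤ 1 := by nlinarith [hx.1]
  have hstab := ftrl_stability (hX := hX) (L := L) hlr ha hy0
  rw [← hp] at hstab
  have hsec : lr * √(p a) * (p a * y ^ 2) ≤ lr * √(p a) * y := by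
    refine mul_le_mul_of_nonneg_left ?_ (by positivity)
    nlinarith
  have hsum : ∑ a' ∈ X, 2 * γ / 3 * ((if a' = aStar then 1 else 0) + γ + lr * √(p a')) * ℓ a' ≤
      2 * γ / 3 * (ℓ aStar + (γ * X.card + lr * √X.card)) := by
    have h1 : ∀ a' ∈ X, 2 * γ / 3 * ((if a' = aStar then 1 else 0) + γ + lr * √(p a')) * ℓ a' ≤
        2 * γ / 3 * ((if a' = aStar then ℓ aStar else 0) + (γ + lr * √(p a'))) := by
      intro a' ha'
      rw [mul_assoc]
      refine mul_le_mul_of_nonneg_left ?_ (by positivity)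
      have h2 : (γ + lr * √(p a')) * ℓ a' ≤ γ + lr * √(p a') :=
        mul_le_of_le_one_right (by positivity) (hℓ a' ha').2
      by_cases he : a' = aStar
      · subst he
        simp only [if_true]
        linarith
      · simp only [he, if_false]
        linarith
    refine (Finset.sum_le_sum h1).trans ?_
    rw [← Finset.mul_sum, Finset.sum_add_distrib, Finset.sum_ite_eq' X aStar, if_pos hStar,
      Finset.sum_add_distrib, Finset.sum_const, nsmul_eq_mul, ← Finset.mul_sum]
    have h3 : ∑ a' ∈ X, √(p a') ≤ √X.card :=
      (Finset.sum_le_sum_of_subset_of_nonneg (Finset.subset_univ X)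
        fun _ _ _ => Real.sqrt_nonneg _).trans (sum_sqrt_le hpm)
    have h4 : lr * ∑ a' ∈ X, √(p a') ≤ lr * √X.card := mul_le_mul_of_nonneg_left h3 hlr.le
    refine mul_le_mul_of_nonneg_left ?_ (by positivity)
    linarith
  set T := ∑ a' ∈ X, 2 * γ / 3 * ((if a' = aStar then 1 else 0) + γ + lr * √(p a')) * ℓ a'
  have hT : 3 / (2 * γ) * T ≤ ℓ aStar + (γ * X.card + lr * √X.card) := by
    calc 3 / (2 * γ) * T ≤ 3 / (2 * γ) * (2 * γ / 3 * (ℓ aStar + (γ * X.card + lr * √X.card))) := by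
          gcongr
      _ = _ := by
          field_simp
  have hU : 3 / (2 * γ) * (U + (2 * γ / 3 * ((if a = aStar then 1 else 0) + γ + lr * √(p a)) * y
      - T)) = 3 / (2 * γ) * U + ((if a = aStar then 1 else 0) + γ + lr * √(p a)) * y
        - 3 / (2 * γ) * T := by
    field_simp
    ring
  have hLs : Function.update L a (L a + y) aStar = L aStar + (if a = aStar then 1 else 0) * y := by
    by_cases he : a = aStar
    · subst he
      simp
    · simp [he, Function.update_of_ne (Ne.symm he)]
  rw [hU, hLs]
  clear hU
  generalize 3 / (2 * γ) * T = t at hT ⊢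
  generalize 3 / (2 * γ) * U = u
  push_cast
  nlinarith

theorem blockRegret_le {aStar : A} (hStar : aStar ∈ X) (hlg : 1 ≤ Real.log (X.card / δ'))
    {J m : ℕ} (hm : m ≤ 2 ^ J) (L : A → ℝ) {U : ℝ} (hU : U ≤ 2 * Real.log (X.card / δ')) :
    blockRegret X hX δ' aStar J m L U ≤ 7 * √(X.card * Real.log (X.card / δ')) * √(2 ^ J) := by
  have hγ : 0 < ixGamma X δ' J := ixGamma_pos hX (by linarith) J
  have hc : (1 : ℝ) ≤ X.card := by exact_mod_cast hX.card_pos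
  have hm' : (m : ℝ) ≤ 2 ^ J := by exact_mod_cast hm
  have hN : (1 : ℝ) ≤ 2 ^ J := one_le_pow₀ (by norm_num)
  set lg := Real.log (X.card / δ') with hlgd
  set n : ℝ := 2 ^ J with hn
  set c : ℝ := (X.card : ℝ) with hcd
  have hsn : √n * √n = n := Real.mul_self_sqrt (by linarith)
  have hsc : √c * √c = c := Real.mul_self_sqrt (by linarith)
  have hsl : √lg * √lg = lg := Real.mul_self_sqrt (by linarith)
  have hn1 : 1 ≤ √n := Real.one_le_sqrt.2 hN
  have hc1 : 1 ≤ √c := Real.one_le_sqrt.2 hc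
  have hl1 : 1 ≤ √lg := Real.one_le_sqrt.2 hlg
  have hγ' : ixGamma X δ' J = √lg / (√c * √n) := by
    rw [ixGamma, Real.sqrt_div (by linarith), Real.sqrt_mul (by linarith)]
  rw [Real.sqrt_mul (by linarith)]
  unfold blockRegret
  split_ifs with hcase
  · have h1 := ftrlObjective_le_loss (hX := hX) (lr := ixRate J) (L := L) hStar
    have h2 := neg_ftrlObjective_zero_le (X := X) (hX := hX) (ixRate_pos J)
    have e2 : 2 * √c / ixRate J = 2 * (√c * √n) := by
      rw [ixRate, ← hn]
      field_simp
    have h3 : 3 / (2 * ixGamma X δ' J) * U ≤ 3 * (√c * √lg * √n) := by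
      calc 3 / (2 * ixGamma X δ' J) * U ≤ 3 / (2 * ixGamma X δ' J) * (2 * lg) := by gcongr
        _ = 3 * (√c * √lg * √n) := by
          rw [hγ']
          field_simp
          rw [pow_two, hsl]
    have h4 : m * (ixGamma X δ' J * c + ixRate J * √c) ≤ √c * √lg * √n + √c * √n := by
      have hr := ixRate_pos J
      calc m * (ixGamma X δ' J * c + ixRate J * √c) ≤ n * (ixGamma X δ' J * c + ixRate J * √c) := by
            gcongr
        _ = √c * √lg * √n + √c * √n := by
          have e : ∀ u w l : ℝ, u ≠ 0 → w ≠ 0 →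
              u * u * (l / (w * u) * (w * w) + 1 / u * w) = w * l * u + w * u := by
            intro u w l hu hw
            field_simp
          have := e √n √c √lg (by positivity) (by positivity)
          rwa [hsn, hsc, ← hγ', hn] at this
    rw [← hcd] at h2
    have h5 : √c * √n ≤ √c * √lg * √n := by
      gcongr
      exact le_mul_of_one_le_right (by linarith) hl1
    generalize 3 / (2 * ixGamma X δ' J) * U = q at h3 ⊢
    linarith
  · -- here `m ≤ 2 ^ J` is at most the logarithm, or equal to `1`
    refine hm'.trans ?_
    have h6 : √n ≤ √lg := by
      by_cases hJ : 1 ≤ J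
      · have h7 : 1 < ixGamma X δ' J := by
          by_contra h
          exact hcase ⟨not_lt.1 h, hJ⟩
        rw [hγ', one_lt_div (by positivity)] at h7
        exact (le_mul_of_one_le_left (by linarith) hc1).trans h7.le
      · have : J = 0 := by omega
        subst this
        rw [hn]
        simpa using hl1
    calc n = 1 * √n * √n := by rw [one_mul, hsn]
      _ ≤ √c * √lg * √n := by gcongr
      _ ≤ 7 * (√c * √lg) * √n := by
        have : 0 ≤ √c * √lg * √n := by positivity
        linarith

end Block

/-! ### Optimism: estimates at one state and step -/

section Visits

variable {A : Type*} [Fintype A] {X : Finset A} {hX : X.Nonempty} {δ' : ℝ}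

/-- What holds of the data at one `(h, s)` while the accumulated deviations `U` stay small. Here
`v` is the optimal value at `(h, s)` and `aStar` an optimal action. Besides the bookkeeping of
the doubling scheme, the content is that the estimate is optimistic (`v ≤ V`) and that the
rewards collected in the current epoch fall short of `v` per visit by at most the bandit
regret. -/
structure VisitInv (X : Finset A) (hX : X.Nonempty) (H : ℕ) (δ' ι : ℝ) (aStar : A) (v U : ℝ)
    (c : EpochState A) : Prop where
  round_lt : c.bandit.round < 2 ^ c.bandit.block
  count_eq : c.count + 1 = 2 ^ c.bandit.block + c.bandit.round
  policy_eq : 1 ≤ c.bandit.block →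
    c.bandit.policy = ftrlPolicy X hX (ixRate c.bandit.block) c.bandit.loss
  loss_eq : c.bandit.round = 0 → c.bandit.loss = 0
  le_V : v ≤ c.V
  regret_le : (c.count * v - c.total) / H ≤
    5 / 2 * (7 * √(X.card * Real.log (X.card / δ'))) * √(2 ^ c.bandit.block) +
      blockRegret X hX δ' aStar c.bandit.block c.bandit.round c.bandit.loss
        (if c.bandit.round = 0 then 0 else U)
  shortfall_le : c.count * v - c.total ≤ √(ι * c.count)

theorem visitInv_fresh {H P : ℕ} {ι v U V : ℝ} {aStar : A} (hvV : v ≤ V) :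
    VisitInv X hX H δ' ι aStar v U
      { V := V, prevCount := P, count := 0, total := 0, bandit := BanditState.fresh X hX } where
  round_lt := by simp [BanditState.fresh]
  count_eq := by simp [BanditState.fresh]
  policy_eq := by simp [BanditState.fresh]
  loss_eq := by simp [BanditState.fresh]
  le_V := hvV
  regret_le := by
    simp only [BanditState.fresh, if_true, blockRegret_start]
    simp only [Nat.cast_zero, zero_mul, sub_zero, zero_div]
    positivity
  shortfall_le := by simp

variable [DecidableEq A]

/-- The invariant survives a visit. The mean losses `ℓ` of the actions are those of the bandit
problem of this visit; optimism at the next step makes the loss of `aStar` at most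
`1 - v / H`. -/
theorem VisitInv.update {H h : ℕ} (hH : 0 < H) {η ι v U : ℝ} {aStar : A} (hStar : aStar ∈ X)
    (hlg : 1 ≤ Real.log (X.card / δ'))
    (hι : 25 * (H * √(X.card * Real.log (X.card / δ'))) ≤ √ι)
    (hvH : v ≤ H - h) {c : EpochState A}
    (hc : VisitInv X hX H δ' ι aStar v U c) {a : A} (ha : a ∈ X) {r w : ℝ}
    (hx : r + w ∈ Set.Icc (0 : ℝ) H) {ℓ : A → ℝ} (hℓ : ∀ a ∈ X, ℓ a ∈ Set.Icc (0 : ℝ) 1)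
    (hℓv : ℓ aStar ≤ 1 - v / H) {U' : ℝ}
    (hU' : U' = (if c.bandit.round = 0 then 0 else U) +
      ixIncrement X δ' aStar c.bandit ℓ a ((r + w) / H))
    (hU : U' ≤ 2 * Real.log (X.card / δ')) :
    VisitInv X hX H δ' ι aStar v U' (c.update H h X hX η ι δ' a r w) := by
  have hH' : (0 : ℝ) < H := by exact_mod_cast hH
  have hxH : (r + w) / H ∈ Set.Icc (0 : ℝ) 1 :=
    ⟨div_nonneg hx.1 hH'.le, (div_le_one hH').2 hx.2⟩
  have hvH1 : v / H ≤ 1 := (div_le_one hH').2 (by linarith [(Nat.cast_nonneg h : (0 : ℝ) ≤ h)])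
  have hstep := blockRegret_step (hX := hX) (m := c.bandit.round)
    (U := if c.bandit.round = 0 then 0 else U) hStar (by linarith) hc.policy_eq ha hxH hvH1 hℓ hℓv
  rw [← hU'] at hstep
  set J := c.bandit.block with hJ
  set L' := Function.update c.bandit.loss a (c.bandit.loss a +
    (1 - (r + w) / H) / ((c.bandit.policy a).toReal + ixGamma X δ' J)) with hL'
  set b := √(X.card * Real.log (X.card / δ')) with hb
  have hb0 : 0 ≤ b := Real.sqrt_nonneg _
  have hblock := blockRegret_le (hX := hX) hStar hlg
    (show c.bandit.round + 1 ≤ 2 ^ J from hc.round_lt) L' hU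
  rw [← hb] at hblock
  have hreg : ((c.count + 1 : ℕ) * v - (c.total + (r + w))) / H ≤
      5 / 2 * (7 * b) * √(2 ^ J) +
        blockRegret X hX δ' aStar J (c.bandit.round + 1) L' U' := by
    have e : ((c.count + 1 : ℕ) * v - (c.total + (r + w))) / H =
        (c.count * v - c.total) / H + (v / H - (r + w) / H) := by
      push_cast
      ring
    rw [e]
    exact (add_le_add hc.regret_le le_rfl).trans (by rw [add_assoc]; exact add_le_add le_rfl hstep)
  have hpow : (2 : ℝ) ^ J ≤ (c.count + 1 : ℕ) := by
    rw [hc.count_eq]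
    push_cast
    linarith only [(Nat.cast_nonneg c.bandit.round : (0 : ℝ) ≤ c.bandit.round)]
  have hshort : (c.count + 1 : ℕ) * v - (c.total + (r + w)) ≤ √(ι * (c.count + 1 : ℕ)) := by
    have h1 : ((c.count + 1 : ℕ) * v - (c.total + (r + w))) / H ≤ 25 * b * √(2 ^ J) := by
      have : 0 ≤ b * √(2 ^ J) := by positivity
      exact hreg.trans (by linarith only [this, hblock])
    rw [div_le_iff₀ hH'] at h1
    have hι0 : 0 ≤ ι := by
      by_contra hneg
      rw [Real.sqrt_eq_zero_of_nonpos (not_le.1 hneg).le] at hι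
      have hc1 : (1 : ℝ) ≤ X.card := by exact_mod_cast hX.card_pos
      have : 0 < b := Real.sqrt_pos.2 (by positivity)
      have : 0 < (H : ℝ) * b := by positivity
      linarith only [this, hι]
    rw [Real.sqrt_mul hι0]
    calc (c.count + 1 : ℕ) * v - (c.total + (r + w)) ≤ 25 * b * √(2 ^ J) * H := h1
      _ = 25 * (H * b) * √(2 ^ J) := by ring
      _ ≤ √ι * √(c.count + 1 : ℕ) := by gcongr
  unfold EpochState.update
  simp only
  split_ifs with hend
  · refine visitInv_fresh (le_min hvH ?_)
    have hn : (0 : ℝ) < (c.count + 1 : ℕ) := by exact_mod_cast Nat.succ_pos _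
    set n : ℝ := ((c.count + 1 : ℕ) : ℝ) with hnd
    have e : √(ι * n) = n * √(ι / n) := by
      rw [show ι * n = n ^ 2 * (ι / n) by field_simp, Real.sqrt_mul (sq_nonneg n),
        Real.sqrt_sq hn.le]
    rw [e] at hshort
    have : v ≤ (c.total + (r + w) + n * √(ι / n)) / n := by
      rw [le_div_iff₀ hn]
      linarith only [hshort]
    rwa [add_div, mul_div_cancel_left₀ _ hn.ne'] at this
  · have hcount := hc.count_eq
    unfold BanditState.update
    simp only
    split_ifs with hblk
    · rw [← hJ] at hblk hcount
      refine ⟨?_, ?_, ?_, ?_, hc.le_V, ?_, hshort⟩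
      · simp
      · simp only
        rw [pow_succ, ← hJ]
        omega
      · intro _
        simp [ixRate]
      · simp
      · simp only [if_true, blockRegret_start, ← hJ]
        refine hreg.trans ?_
        have h2 : √((2 : ℝ) ^ (J + 1)) = √(2 ^ J) * √2 := by
          rw [pow_succ, Real.sqrt_mul (by positivity)]
        have h3 : (7 / 5 : ℝ) ≤ √2 := Real.le_sqrt_of_sq_le (by norm_num)
        have h4 : b * √(2 ^ J) * (7 / 5) ≤ b * √(2 ^ J) * √2 := by gcongr
        rw [h2, ← hb]
        linarith only [h4, hblock]
    · have hlt := hc.round_lt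
      rw [← hJ] at hblk hcount hlt
      refine ⟨?_, ?_, ?_, ?_, hc.le_V, ?_, hshort⟩
      · simp only [← hJ]
        omega
      · simp only [← hJ]
        omega
      · intro _
        simp only [ixRate, ← hJ]
      · simp
      · simp only [Nat.succ_ne_zero, if_false, ← hJ, ← hb]
        exact hreg

end Visits

/-! ### Epochs: the estimates change slowly -/

section Epochs

variable {A : Type*}

/-- The part of the sum of `V - x - φ / (H + 1) - √ι θ / 2` over all visits that stems from the
current, incomplete epoch, where `x` is the reward plus the estimate of the next state, and
`φ = V - v`. -/
def currentExcess (H : ℕ) (ι θ v : ℝ) (c : EpochState A) : ℝ :=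
  c.count * c.V - c.total - c.count * ((c.V - v) / (H + 1)) - c.count * (√ι * θ / 2)

/-- What holds of the epochs at one `(h, s)` after at most `k` visits, if `g` is the sum of
`V - x - φ / (H + 1) - √ι θ / 2` over all visits so far. Here `(H + 1) log prevCount` bounds the
number of complete epochs. The free parameter `θ` replaces `√N` by the linear bound
`(θ N + 1 / θ) / 2`, so that all bounds are additive over states and visits. -/
structure EpochInv (H : ℕ) (ι θ v : ℝ) (k : ℕ) (g : ℝ) (c : EpochState A) : Prop where
  one_le_prevCount : 1 ≤ c.prevCount
  prevCount_le : c.prevCount ≤ max 1 k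
  count_le : c.count ≤ k
  count_lt : c.count < ⌈(1 + 1 / (H : ℝ)) * c.prevCount⌉₊
  excess_le : g - currentExcess H ι θ v c + c.prevCount * (c.V - v) ≤
    (H + √ι / (2 * θ)) * ((H + 1) * Real.log c.prevCount) + H

theorem sqrt_mul_le_linear {θ : ℝ} (hθ : 0 < θ) {ι : ℝ} (n : ℕ) :
    √(ι * n) ≤ √ι * (θ * n + 1 / θ) / 2 := by
  have hn : (0 : ℝ) ≤ n := Nat.cast_nonneg n
  rw [mul_comm ι, Real.sqrt_mul hn, mul_comm (√(n : ℝ)), mul_div_assoc]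
  refine mul_le_mul_of_nonneg_left ?_ (Real.sqrt_nonneg ι)
  refine Real.sqrt_le_iff.2 ⟨by positivity, ?_⟩
  have e : ((θ * n + 1 / θ) / 2) ^ 2 = n + ((θ * n - 1 / θ) / 2) ^ 2 := by
    field_simp
    ring
  rw [e]
  linarith [sq_nonneg ((θ * n - 1 / θ) / 2)]

theorem EpochInv.mono {H : ℕ} {ι θ v g : ℝ} {k k' : ℕ} (hk : k ≤ k') {c : EpochState A}
    (hc : EpochInv H ι θ v k g c) : EpochInv H ι θ v k' g c :=
  ⟨hc.1, hc.2.trans (max_le_max le_rfl hk), hc.3.trans hk, hc.4, hc.5⟩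

theorem epochInv_init {H : ℕ} {ι θ v V : ℝ} (hv : 0 ≤ v) (hV : V ≤ H) (bd : BanditState A) :
    EpochInv H ι θ v 0 0 { V := V, prevCount := 1, count := 0, total := 0, bandit := bd } where
  one_le_prevCount := le_rfl
  prevCount_le := le_max_left _ _
  count_le := le_rfl
  count_lt := by
    simp only [Nat.cast_one, mul_one, Nat.lt_ceil, Nat.cast_zero]
    positivity
  excess_le := by
    simp [currentExcess]
    linarith

/-- At the end of the run, the sum of `V - x - φ / (H + 1) - √ι θ / 2` over all visits is small:
the incomplete epoch is controlled by the bandit regret (`hshort`). -/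
theorem EpochInv.sum_le {H k : ℕ} (hH : 0 < H) {ι θ v g : ℝ} (hθ : 0 < θ) {c : EpochState A}
    (hc : EpochInv H ι θ v k g c) (hk : 1 ≤ k) (hvV : v ≤ c.V)
    (hshort : c.count * v - c.total ≤ √(ι * c.count)) :
    g ≤ (H + √ι / (2 * θ)) * (1 + (H + 1) * Real.log k) := by
  have hH' : (0 : ℝ) < H := by exact_mod_cast hH
  have hex := hc.excess_le
  unfold currentExcess at hex
  have hP1 : (1 : ℝ) ≤ c.prevCount := by exact_mod_cast hc.one_le_prevCount
  have hPk : (c.prevCount : ℝ) ≤ k := by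
    exact_mod_cast hc.prevCount_le.trans (max_le hk le_rfl)
  have hcount : (c.count : ℝ) < (1 + 1 / (H : ℝ)) * c.prevCount := Nat.lt_ceil.1 hc.count_lt
  have hlin := hshort.trans (sqrt_mul_le_linear hθ c.count)
  have hlin' : √ι * (θ * c.count + 1 / θ) / 2 = c.count * (√ι * θ / 2) + √ι / (2 * θ) := by
    field_simp
  have hcP : (c.count - c.prevCount) * (c.V - v) ≤ c.count * ((c.V - v) / (H + 1)) := by
    have h1 : (c.count : ℝ) - c.prevCount ≤ c.count / (H + 1) := by
      rw [le_div_iff₀ (by positivity)]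
      have := mul_lt_mul_of_pos_right hcount hH'
      have e : (1 + 1 / (H : ℝ)) * c.prevCount * H = (H + 1) * c.prevCount := by field_simp
      linarith
    calc (c.count - c.prevCount) * (c.V - v) ≤ c.count / (H + 1) * (c.V - v) := by
          gcongr
      _ = _ := by ring
  have hκ : 0 ≤ √ι / (2 * θ) := by positivity
  have hlog : (H + √ι / (2 * θ)) * ((H + 1) * Real.log c.prevCount) ≤
      (H + √ι / (2 * θ)) * ((H + 1) * Real.log k) := by
    gcongr
  rw [hlin'] at hlin
  linarith

variable [Fintype A] [DecidableEq A] {X : Finset A} {hX : X.Nonempty} {δ' : ℝ}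

/-- The invariant survives a visit. At the end of an epoch of length `N`, the sum of `V - x` over
the epoch is at most `N (V - V')` plus the bonus, where `V'` is the new estimate; summation by
parts turns this into `(N - prevCount) (V - v)`, and `N - prevCount` is about `N / (H + 1)`. -/
theorem EpochInv.update {H h k : ℕ} (hH : 0 < H) {ι θ v g : ℝ} (hθ : 0 < θ) {c : EpochState A}
    (hc : EpochInv H ι θ v k g c) (hv0 : 0 ≤ v) (hvV : v ≤ c.V) (hVH : c.V ≤ H) (a : A) (r w : ℝ) :
    EpochInv H ι θ v (k + 1) (g + (c.V - (r + w) - (c.V - v) / (H + 1) - √ι * θ / 2))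
      (c.update H h X hX (1 / H) ι δ' a r w) := by
  have hH' : (0 : ℝ) < H := by exact_mod_cast hH
  have hex := hc.excess_le
  have hk1 := hc.count_le
  have hk2 := hc.prevCount_le
  unfold EpochState.update
  simp only
  unfold currentExcess at hex
  split_ifs with hend
  · have hP1 : (1 : ℝ) ≤ c.prevCount := by exact_mod_cast hc.one_le_prevCount
    have hN1 : (1 + 1 / (H : ℝ)) * c.prevCount ≤ (c.count + 1 : ℕ) := by
      rw [hend]
      exact Nat.le_ceil _
    have hN2 : ((c.count + 1 : ℕ) : ℝ) < (1 + 1 / (H : ℝ)) * c.prevCount + 1 := by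
      rw [hend]
      exact Nat.ceil_lt_add_one (by positivity)
    have hlin := sqrt_mul_le_linear hθ (ι := ι) (c.count + 1)
    have hn : (0 : ℝ) < (c.count + 1 : ℕ) := by exact_mod_cast Nat.succ_pos _
    refine ⟨by simp, ?_, by simp, ?_, ?_⟩
    · simp only
      omega
    · simp only [Nat.lt_ceil, Nat.cast_zero]
      positivity
    simp only [currentExcess, Nat.cast_zero, zero_mul, sub_zero]
    set N : ℝ := ((c.count + 1 : ℕ) : ℝ) with hNd
    have hcN : (c.count : ℝ) = N - 1 := by
      rw [hNd]
      push_cast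
      ring
    set P : ℝ := (c.prevCount : ℝ) with hPd
    have hlog : 1 ≤ (H + 1) * (Real.log N - Real.log P) := by
      have h1 : 1 + 1 / (H : ℝ) ≤ N / P := by rwa [le_div_iff₀ (by linarith)]
      have h2 := Real.one_sub_inv_le_log_of_pos (show (0 : ℝ) < 1 + 1 / H by positivity)
      have h3 : Real.log (1 + 1 / (H : ℝ)) ≤ Real.log (N / P) :=
        Real.log_le_log (by positivity) h1
      rw [Real.log_div hn.ne' (by linarith)] at h3
      have h4 : 1 - (1 + 1 / (H : ℝ))⁻¹ = 1 / (H + 1) := by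
        field_simp
        ring
      rw [h4] at h2
      have h5 := mul_le_mul_of_nonneg_left (h2.trans h3) (show (0 : ℝ) ≤ H + 1 by positivity)
      rwa [mul_one_div_cancel (by positivity)] at h5
    set V' := min ((H : ℝ) - h) ((c.total + (r + w)) / N + √(ι / N)) with hV'
    have hNV' : N * V' ≤ c.total + (r + w) + √(ι * N) := by
      have h1 : V' ≤ (c.total + (r + w)) / N + √(ι / N) := min_le_right _ _
      have e : √(ι * N) = N * √(ι / N) := by
        rw [show ι * N = N ^ 2 * (ι / N) by field_simp, Real.sqrt_mul (sq_nonneg N),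
          Real.sqrt_sq hn.le]
      rw [e]
      calc N * V' ≤ N * ((c.total + (r + w)) / N + √(ι / N)) := by gcongr
        _ = _ := by field_simp
    have hNP : (N - P) * (c.V - v) ≤ N * ((c.V - v) / (H + 1)) + (c.V - v) := by
      have h1 : N - P ≤ N / (H + 1) + 1 := by
        rw [div_add_one (by positivity), le_div_iff₀ (by positivity)]
        have h2 : (N - 1) * H < (H + 1) * P := by
          have := mul_lt_mul_of_pos_right (show N - 1 < (1 + 1 / (H : ℝ)) * P by linarith) hH'
          have e : (1 + 1 / (H : ℝ)) * P * H = (H + 1) * P := by field_simp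
          linarith
        linarith
      calc (N - P) * (c.V - v) ≤ (N / (H + 1) + 1) * (c.V - v) := by
            gcongr
        _ = _ := by ring
    have hκ : 0 ≤ √ι / (2 * θ) := by positivity
    have hgrow : H + √ι / (2 * θ) ≤
        (H + √ι / (2 * θ)) * ((H + 1) * (Real.log N - Real.log P)) :=
      le_mul_of_one_le_right (by positivity) hlog
    have hlin' : √ι * (θ * N + 1 / θ) / 2 = N * (√ι * θ / 2) + √ι / (2 * θ) := by
      field_simp
    rw [hcN] at hex
    rw [hlin'] at hlin
    nlinarith
  · have := hc.count_lt
    refine ⟨hc.1, ?_, ?_, ?_, ?_⟩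
    · simp only
      omega
    · simp only
      omega
    · simp only
      omega
    · simp only [currentExcess]
      push_cast
      linarith

end Epochs

/-! ### Sums and expectations over the interaction -/

section Interaction

variable {S A B : Type*} {H : ℕ}

/-- The sum over the episodes of a record of a quantity that depends on the episode and on the
record before it. -/
def runSum (f : (k : ℕ) → History S A B H k → Episode S A B H → ℝ) :
    (k : ℕ) → History S A B H k → ℝ
  | 0, _ => 0
  | k + 1, ω => runSum f k (fun i => ω i.castSucc) +
      f k (fun i => ω i.castSucc) (ω (Fin.last k))

theorem runSum_eq_sum (f : (k : ℕ) → History S A B H k → Episode S A B H → ℝ) :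
    ∀ (K : ℕ) (ω : History S A B H K), runSum f K ω = ∑ k : Fin K,
      f k (Fin.take (α := fun _ : Fin K => Episode S A B H) k k.is_lt.le ω) (ω k)
  | 0, _ => rfl
  | K + 1, ω => by
    rw [runSum, runSum_eq_sum f K, Fin.sum_univ_castSucc]
    rfl

/-- The value at the state of step `h + 1` of an episode, and `0` after the last step. -/
def nextVal (V : S → ℝ) (h : ℕ) (e : Episode S A B H) : ℝ :=
  if hn : h + 1 < H then V (e ⟨h + 1, hn⟩).1 else 0

theorem snoc_init {k : ℕ} (ω : History S A B H k) (e : Episode S A B H) :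
    (fun i => Fin.snoc (α := fun _ : Fin (k + 1) => Episode S A B H) ω e i.castSucc) = ω := by
  funext i
  simp

variable {G : MarkovGame S A B H} {learner : (k : ℕ) → History S A B H k → Policy S A}
  {opponent : (k : ℕ) → History S A B H k → Policy S B}
  {initial : (k : ℕ) → History S A B H k → PMF S}

/-- Every state and action of the episode belongs to its layer. -/
def MarkovGame.Legal (G : MarkovGame S A B H) (e : Episode S A B H) : Prop :=
  ∀ i : Fin H, (e i).1 ∈ G.states i ∧ (e i).2.1 ∈ G.actions i ∧ (e i).2.2 ∈ G.oppActions i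

theorem legal_of_mem_support {μ : Policy S A} {ν : Policy S B} (hμ : G.IsLearnerPolicy μ)
    (hν : G.IsOppPolicy ν) {s : S} (hs : s ∈ G.states 0) {e : Episode S A B H}
    (he : e ∈ (G.rollout μ ν H 0 s).support) : G.Legal e := by
  intro i
  simpa using MarkovGame.mem_of_mem_support_rollout hμ hν H 0 s (by omega) hs e he i

theorem mem_support_interactionLaw_succ (hμ : ∀ k ω, G.IsLearnerPolicy (learner k ω))
    (hν : ∀ k ω, G.IsOppPolicy (opponent k ω))
    (h₀ : ∀ k ω, (initial k ω).support ⊆ (G.states 0 : Set S)) {k : ℕ}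
    {ω : History S A B H (k + 1)}
    (hω : ω ∈ (interactionLaw G learner opponent initial (k + 1)).support) :
    (fun i => ω i.castSucc) ∈ (interactionLaw G learner opponent initial k).support ∧
      G.Legal (ω (Fin.last k)) := by
  simp only [interactionLaw, PMF.mem_support_bind_iff, PMF.mem_support_map_iff] at hω
  obtain ⟨ω', hω', s, hs, e, he, rfl⟩ := hω
  rw [snoc_init, Fin.snoc_last]
  exact ⟨hω', legal_of_mem_support (hμ k ω') (hν k ω') (h₀ k ω' hs) he⟩

theorem reward_add_nextVal_mem {e : Episode S A B H} (he : G.Legal e) {h : ℕ} (hh : h < H)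
    {V : S → ℝ} (hV : h + 1 < H → ∀ s ∈ G.states (h + 1), V s ∈ Set.Icc (0 : ℝ) (H - (h + 1 : ℕ))) :
    G.reward h (e ⟨h, hh⟩).1 (e ⟨h, hh⟩).2.1 (e ⟨h, hh⟩).2.2 + nextVal V h e ∈
      Set.Icc (0 : ℝ) H := by
  have hl := he ⟨h, hh⟩
  have hr := G.reward_mem h hh _ hl.1 _ hl.2.1 _ hl.2.2
  have hh' : (h : ℝ) + 1 ≤ H := by exact_mod_cast hh
  have h0 : (0 : ℝ) ≤ h := Nat.cast_nonneg h
  unfold nextVal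
  split_ifs with hn
  · have hv := hV hn _ (he ⟨h + 1, hn⟩).1
    push_cast at hv
    exact ⟨by linarith [hr.1, hv.1], by linarith [hr.2, hv.2]⟩
  · exact ⟨by linarith [hr.1], by linarith [hr.2]⟩

variable [Fintype S] [Fintype A] [Fintype B]

theorem expect_interactionLaw_succ (k : ℕ) (f : History S A B H (k + 1) → ℝ) :
    expect (interactionLaw G learner opponent initial (k + 1)) f =
      expect (interactionLaw G learner opponent initial k) fun ω =>
        expect (initial k ω) fun s =>
          expect (G.rollout (learner k ω) (opponent k ω) H 0 s) fun e =>
            f (Fin.snoc (α := fun _ : Fin (k + 1) => Episode S A B H) ω e) := by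
  simp only [interactionLaw, expect_bind, expect_map]

theorem expect_interactionLaw_init (k : ℕ) (g : History S A B H k → ℝ) :
    expect (interactionLaw G learner opponent initial (k + 1)) (fun ω => g fun i => ω i.castSucc) =
      expect (interactionLaw G learner opponent initial k) g := by
  rw [expect_interactionLaw_succ]
  simp only [snoc_init, expect_const]

/-- A one-episode bound on conditional expectations gives a bound on expectations. -/
theorem expect_interactionLaw_succ_le
    (h₀ : ∀ k ω, (initial k ω).support ⊆ (G.states 0 : Set S)) (k : ℕ)
    {f : History S A B H (k + 1) → ℝ} {g : History S A B H k → ℝ}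
    (hfg : ∀ ω ∈ (interactionLaw G learner opponent initial k).support, ∀ s ∈ G.states 0,
      expect (G.rollout (learner k ω) (opponent k ω) H 0 s) (fun e =>
        f (Fin.snoc (α := fun _ : Fin (k + 1) => Episode S A B H) ω e)) ≤ g ω) :
    expect (interactionLaw G learner opponent initial (k + 1)) f ≤
      expect (interactionLaw G learner opponent initial k) g := by
  rw [expect_interactionLaw_succ]
  exact expect_mono fun ω hω => expect_le fun s hs => hfg ω hω s (h₀ k ω hs)

theorem expect_episode_le {μ : Policy S A} {ν : Policy S B} (hμ : G.IsLearnerPolicy μ)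
    (hν : G.IsOppPolicy ν) {h : ℕ} (hh : h < H) {s₁ : S} (hs₁ : s₁ ∈ G.states 0)
    (F : S → A → B → ℝ → ℝ) (V : S → ℝ) (c : ℝ)
    (hc : ∀ s ∈ G.states h, expect (μ h s) (fun a => expect (ν h s) fun b =>
      expect (G.transition h s a b) fun s' => F s a b (if h + 1 < H then V s' else 0)) ≤ c) :
    expect (G.rollout μ ν H 0 s₁) (fun e => F (e ⟨h, hh⟩).1 (e ⟨h, hh⟩).2.1 (e ⟨h, hh⟩).2.2
      (nextVal V h e)) ≤ c :=
  MarkovGame.expect_rollout_le hμ hν F V c h H 0 hh s₁ (by omega) hs₁ (by simpa using hc)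

/-! ### Concentration of the realized rewards -/

theorem exp_le_one_add_add_sq {y : ℝ} (hy : |y| ≤ 1) : Real.exp y ≤ 1 + y + y ^ 2 := by
  have := (abs_le.1 (Real.abs_exp_sub_one_sub_id_le hy)).2
  linarith

/-- The temporal-difference error at step `h` of the value of the policies of an episode. -/
def valueNoise (G : MarkovGame S A B H) (ν : Policy S B)
    (learner : (k : ℕ) → History S A B H k → Policy S A) (h : ℕ) (k : ℕ)
    (ω : History S A B H k) (e : Episode S A B H) : ℝ :=
  if hh : h < H then
    G.reward h (e ⟨h, hh⟩).1 (e ⟨h, hh⟩).2.1 (e ⟨h, hh⟩).2.2 +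
      nextVal (G.value (learner k ω) ν (h + 1)) h e - G.value (learner k ω) ν h (e ⟨h, hh⟩).1
  else 0

variable {ν : Policy S B}

theorem expect_exp_tdError_le {μ : Policy S A} (hμ : G.IsLearnerPolicy μ) (hν : G.IsOppPolicy ν)
    {lam : ℝ} (h0 : 0 ≤ lam) (h1 : lam * H ≤ 1) {h : ℕ} (hh : h < H) {s : S}
    (hs : s ∈ G.states h) :
    expect (μ h s) (fun a => expect (ν h s) fun b => expect (G.transition h s a b) fun s' =>
      Real.exp (lam * (G.reward h s a b + (if h + 1 < H then G.value μ ν (h + 1) s' else 0) -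
        G.value μ ν h s) - lam ^ 2 * H ^ 2)) ≤ 1 := by
  have hV : ∀ s', (if h + 1 < H then G.value μ ν (h + 1) s' else 0) = G.value μ ν (h + 1) s' := by
    intro s'
    split_ifs with h2
    · rfl
    · obtain rfl : H = h + 1 := by omega
      rw [MarkovGame.value_terminal]
  simp only [hV]
  have hbd : ∀ a ∈ (μ h s).support, ∀ b ∈ (ν h s).support, ∀ s' ∈ (G.transition h s a b).support,
      Real.exp (lam * (G.reward h s a b + G.value μ ν (h + 1) s' -
        G.value μ ν h s) - lam ^ 2 * H ^ 2) ≤ Real.exp (-(lam ^ 2 * H ^ 2)) *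
        (1 + lam ^ 2 * H ^ 2 + lam * ((G.reward h s a b + G.value μ ν (h + 1) s') -
        G.value μ ν h s)) := by
    intro a ha b hb s' hs'
    have ha := hμ h hh s hs ha
    have hb := hν h hh s hs hb
    have hs' := G.transition_support h hh s hs a ha b hb hs'
    have hr := G.reward_mem h hh s hs a ha b hb
    have hv := MarkovGame.value_mem hμ hν (H - h) h (by omega) s hs
    have hv' := MarkovGame.value_mem hμ hν (H - h - 1) (h + 1) (by omega) s' hs'
    have e1 : ((H - h : ℕ) : ℝ) ≤ H := by exact_mod_cast Nat.sub_le H h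
    have e2 : ((H - h - 1 : ℕ) : ℝ) + 1 ≤ H := by
      have : H - h - 1 + 1 ≤ H := by omega
      exact_mod_cast this
    set ξ := G.reward h s a b + G.value μ ν (h + 1) s' - G.value μ ν h s with hξ
    have hξ1 : |ξ| ≤ H := abs_le.2 ⟨by linarith [hr.1, hv'.1, hv.2], by
      linarith [hr.2, hv'.2, hv.1]⟩
    have h3 : |lam * ξ| ≤ lam * H := by
      rw [abs_mul, abs_of_nonneg h0]
      exact mul_le_mul_of_nonneg_left hξ1 h0
    have h4 : (lam * ξ) ^ 2 ≤ lam ^ 2 * H ^ 2 := by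
      rw [← mul_pow, ← sq_abs]
      exact pow_le_pow_left₀ (abs_nonneg _) h3 2
    rw [sub_eq_neg_add, Real.exp_add]
    refine mul_le_mul_of_nonneg_left ?_ (Real.exp_pos _).le
    linarith [exp_le_one_add_add_sq (h3.trans h1)]
  refine (expect_mono fun a ha => expect_mono fun b hb => expect_mono fun s' hs' =>
    hbd a ha b hb s' hs').trans ?_
  have hmean : expect (μ h s) (fun a => expect (ν h s) fun b => expect (G.transition h s a b)
      fun s' => Real.exp (-(lam ^ 2 * H ^ 2)) * (1 + lam ^ 2 * H ^ 2 + lam *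
        ((G.reward h s a b + G.value μ ν (h + 1) s') - G.value μ ν h s))) =
      Real.exp (-(lam ^ 2 * H ^ 2)) * (1 + lam ^ 2 * H ^ 2) := by
    have hB : G.value μ ν h s = expect (μ h s) fun a => expect (ν h s) fun b =>
        G.reward h s a b + expect (G.transition h s a b) (G.value μ ν (h + 1)) :=
      MarkovGame.value_eq hh s
    simp only [expect_add] at hB
    simp only [expect_const_mul, expect_add, expect_sub, expect_const]
    rw [hB]
    ring
  rw [hmean, Real.exp_neg, inv_mul_le_iff₀ (Real.exp_pos _), mul_one, add_comm]
  exact Real.add_one_le_exp _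

/-- The exponential moment of the accumulated temporal-difference errors. -/
theorem expect_exp_valueNoise_le (hμ : ∀ k ω, G.IsLearnerPolicy (learner k ω))
    (hν : G.IsOppPolicy ν) (h₀ : ∀ k ω, (initial k ω).support ⊆ (G.states 0 : Set S))
    {lam : ℝ} (hlam0 : 0 ≤ lam) (hlam1 : lam * H ≤ 1) {h : ℕ} (hh : h < H) : ∀ k : ℕ,
    expect (interactionLaw G learner (fun _ _ => ν) initial k) (fun ω =>
      Real.exp (lam * runSum (valueNoise G ν learner h) k ω - k * (lam ^ 2 * H ^ 2))) ≤ 1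
  | 0 => by simp [runSum, expect_const]
  | k + 1 => by
    refine (expect_interactionLaw_succ_le h₀ k (g := fun ω =>
      Real.exp (lam * runSum (valueNoise G ν learner h) k ω - k * (lam ^ 2 * H ^ 2)))
      fun ω _ s₁ hs₁ => ?_).trans (expect_exp_valueNoise_le hμ hν h₀ hlam0 hlam1 hh k)
    simp only [runSum, snoc_init, Fin.snoc_last, valueNoise, hh, dif_pos]
    set R := runSum (valueNoise G ν learner h) k ω
    refine expect_episode_le (hμ k ω) hν hh hs₁ (fun s a b v => Real.exp (lam * (R +
      (G.reward h s a b + v - G.value (learner k ω) ν h s)) -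
        ((k + 1 : ℕ) : ℝ) * (lam ^ 2 * H ^ 2))) _ _ fun s hs => ?_
    have hsplit : ∀ x : ℝ, Real.exp (lam * (R + x) - ((k + 1 : ℕ) : ℝ) * (lam ^ 2 * H ^ 2)) =
        Real.exp (lam * R - k * (lam ^ 2 * H ^ 2)) *
          Real.exp (lam * x - lam ^ 2 * H ^ 2) := by
      intro x
      rw [← Real.exp_add]
      push_cast
      ring_nf
    simp only [hsplit, expect_const_mul]
    exact mul_le_of_le_one_right (Real.exp_pos _).le
      (expect_exp_tdError_le (hμ k ω) hν hlam0 hlam1 hh hs)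

end Interaction

/-! ### Concentration of the bandit loss estimates -/

section MeanLoss

variable {S A B : Type*} {H : ℕ}

theorem BanditState.policy_support_fresh {X : Finset A} {hX : X.Nonempty} :
    (BanditState.fresh X hX).policy.support ⊆ (X : Set A) := by
  intro a ha
  simpa [BanditState.fresh] using ha

/-- The elementary inequality behind implicit exploration. -/
theorem exp_ix_le {w p γ l : ℝ} (hw : 0 ≤ w) (hwγ : w ≤ 2 * γ) (hp : 0 < p)
    (hl : l ∈ Set.Icc (0 : ℝ) 1) : Real.exp (w * (l / (p + γ))) ≤ 1 + w / p * l := by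
  have hy : 0 ≤ w / p * l := mul_nonneg (div_nonneg hw hp.le) hl.1
  rw [← Real.le_log_iff_exp_le (by linarith)]
  refine le_trans ?_ (Real.le_log_one_add_of_nonneg hy)
  have h1 : w * l ≤ w := mul_le_of_le_one_right hw hl.2
  have h2 : 0 < p + γ := by linarith
  have e : 2 * (w / p * l) / (w / p * l + 2) = w * l / (p + w * l / 2) := by
    field_simp
    ring
  have h3 : 0 ≤ w * l := mul_nonneg hw hl.1
  rw [e, ← mul_div_assoc]
  refine div_le_div_of_nonneg_left h3 (by linarith) (by linarith)

theorem card_states_le [DecidableEq S] {G : MarkovGame S A B H} {h : ℕ} (hh : h ≤ H) :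
    (G.states h).card ≤ G.numStates :=
  Finset.card_le_card (Finset.subset_biUnion_of_mem G.states (Finset.mem_range.2 (by omega)))

variable [Fintype S] [Fintype B] {G : MarkovGame S A B H} {ν : Policy S B}

/-- The estimates `V_{h+1}` held by the algorithm, with value `0` after the last step. -/
def nextEst (H : ℕ) (c : ℕ → S → EpochState A) (h : ℕ) (s : S) : ℝ :=
  if h + 1 < H then (c (h + 1) s).V else 0

/-- The mean loss that action `a` brings to the bandit subroutine at `(h, s)` when the algorithm
holds the data `c`. -/
def meanLoss (G : MarkovGame S A B H) (ν : Policy S B) (c : ℕ → S → EpochState A) (h : ℕ) (s : S)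
    (a : A) : ℝ :=
  1 - G.qVal ν h (nextEst H c h) s a / H

theorem qVal_nextEst_mem (hν : G.IsOppPolicy ν) {c : ℕ → S → EpochState A} {h : ℕ} (hh : h < H)
    (hV : ∀ h < H, ∀ s ∈ G.states h, (c h s).V ∈ Set.Icc (0 : ℝ) (H - h)) {s : S}
    (hs : s ∈ G.states h) {a : A} (ha : a ∈ G.actions h) :
    G.qVal ν h (nextEst H c h) s a ∈ Set.Icc (0 : ℝ) H := by
  have hh' : (h : ℝ) + 1 ≤ H := by exact_mod_cast hh
  have h0 : (0 : ℝ) ≤ h := Nat.cast_nonneg h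
  have := MarkovGame.qVal_mem hν hh (V := nextEst H c h) (c := H - 1) (fun s' hs' => by
    unfold nextEst
    split_ifs with hn
    · have := hV (h + 1) hn s' hs'
      push_cast at this
      exact ⟨this.1, by linarith [this.2]⟩
    · exact ⟨le_rfl, by linarith⟩) hs ha
  simpa using this

theorem meanLoss_mem (hν : G.IsOppPolicy ν) {c : ℕ → S → EpochState A} {h : ℕ} (hh : h < H)
    (hV : ∀ h < H, ∀ s ∈ G.states h, (c h s).V ∈ Set.Icc (0 : ℝ) (H - h)) {s : S}
    (hs : s ∈ G.states h) {a : A} (ha : a ∈ G.actions h) :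
    meanLoss G ν c h s a ∈ Set.Icc (0 : ℝ) 1 := by
  have hH : (0 : ℝ) < H := by exact_mod_cast Nat.zero_lt_of_lt hh
  have := qVal_nextEst_mem hν hh hV hs ha
  have h1 : 0 ≤ G.qVal ν h (nextEst H c h) s a / H := div_nonneg this.1 hH.le
  have h2 : G.qVal ν h (nextEst H c h) s a / H ≤ 1 := (div_le_one hH).2 this.2
  unfold meanLoss
  exact ⟨by linarith, by linarith⟩

variable [Fintype A] [DecidableEq A] {δ' : ℝ}

theorem expect_exp_ixIncrement_le (hν : G.IsOppPolicy ν) {c : ℕ → S → EpochState A} {h : ℕ}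
    (hh : h < H) (hV : ∀ h < H, ∀ s ∈ G.states h, (c h s).V ∈ Set.Icc (0 : ℝ) (H - h)) {s : S}
    (hs : s ∈ G.states h) (hpol : (c h s).bandit.policy.support ⊆ (G.actions h : Set A))
    (aStar : A) :
    expect (c h s).bandit.policy (fun a => expect (ν h s) fun b =>
      expect (G.transition h s a b) fun s' => Real.exp (ixIncrement (G.actions h) δ' aStar
        (c h s).bandit (meanLoss G ν c h s) a
          ((G.reward h s a b + nextEst H c h s') / H))) ≤ 1 := by
  have hH : (0 : ℝ) < H := by exact_mod_cast Nat.zero_lt_of_lt hh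
  set st := (c h s).bandit
  set p : A → ℝ := fun a => (st.policy a).toReal with hp
  set w : A → ℝ := ixWeight (G.actions h) δ' aStar st.block p with hwd
  set γ := ixGamma (G.actions h) δ' st.block
  set ℓ := meanLoss G ν c h s with hℓ
  set T := ∑ a' ∈ G.actions h, w a' * ℓ a' with hT
  have hp1 : ∀ a, p a ≤ 1 := fun a => ENNReal.toReal_le_of_le_ofReal zero_le_one (by
    simpa using st.policy.coe_le_one a)
  have hw0 : ∀ a, 0 ≤ w a := fun a => ixWeight_nonneg _ _ _ _
  have hwγ : ∀ a, w a ≤ 2 * γ := fun a => ixWeight_le _ _ (hp1 a)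
  have hinner : ∀ a ∈ st.policy.support, expect (ν h s) (fun b =>
      expect (G.transition h s a b) fun s' => Real.exp (ixIncrement (G.actions h) δ' aStar
        st ℓ a ((G.reward h s a b + nextEst H c h s') / H))) ≤
      Real.exp (-T) * (1 + w a / p a * ℓ a) := by
    intro a ha
    have hpa : 0 < p a := ENNReal.toReal_pos ((PMF.mem_support_iff _ _).1 ha)
      (st.policy.apply_ne_top a)
    have ha := hpol ha
    have hbd : ∀ b ∈ (ν h s).support, ∀ s' ∈ (G.transition h s a b).support,
        Real.exp (ixIncrement (G.actions h) δ' aStar st ℓ a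
          ((G.reward h s a b + nextEst H c h s') / H)) ≤ Real.exp (-T) *
            (1 + w a / p a * (1 - 1 / H * (G.reward h s a b + nextEst H c h s'))) := by
      intro b hb s' hs'
      have hb := hν h hh s hs hb
      have hs' := G.transition_support h hh s hs a ha b hb hs'
      have hr := G.reward_mem h hh s hs a ha b hb
      have hh' : (h : ℝ) + 1 ≤ H := by exact_mod_cast hh
      have h0 : (0 : ℝ) ≤ h := Nat.cast_nonneg h
      have hx : G.reward h s a b + nextEst H c h s' ∈ Set.Icc (0 : ℝ) H := by
        unfold nextEst
        split_ifs with hn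
        · have := hV (h + 1) hn s' hs'
          push_cast at this
          exact ⟨by linarith [this.1, hr.1], by linarith [this.2, hr.2]⟩
        · exact ⟨by linarith [hr.1], by linarith [hr.2]⟩
      have hl : 1 - (G.reward h s a b + nextEst H c h s') / H ∈ Set.Icc (0 : ℝ) 1 :=
        ⟨by linarith [(div_le_one hH).2 hx.2], by linarith [div_nonneg hx.1 hH.le]⟩
      have e : ixIncrement (G.actions h) δ' aStar st ℓ a
          ((G.reward h s a b + nextEst H c h s') / H) = -T +
            w a * ((1 - (G.reward h s a b + nextEst H c h s') / H) / (p a + γ)) := by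
        rw [ixIncrement, sub_eq_neg_add]
      rw [e, Real.exp_add, one_div_mul_eq_div]
      exact mul_le_mul_of_nonneg_left (exp_ix_le (hw0 a) (hwγ a) hpa hl) (Real.exp_pos _).le
    refine (expect_mono fun b hb => expect_mono fun s' hs' => hbd b hb s' hs').trans
      (le_of_eq ?_)
    have hq : expect (ν h s) (fun b => G.reward h s a b + expect (G.transition h s a b)
      (nextEst H c h)) = G.qVal ν h (nextEst H c h) s a := rfl
    simp only [expect_const_mul, expect_add, expect_sub, expect_const] at hq ⊢
    rw [hq, hℓ, meanLoss, one_div_mul_eq_div]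
  refine (expect_mono hinner).trans ?_
  rw [expect_const_mul, Real.exp_neg, inv_mul_le_iff₀ (Real.exp_pos _), mul_one, expect_add,
    expect_const, add_comm]
  refine le_trans (add_le_add_left ?_ _) (Real.add_one_le_exp T)
  have hsub : ∀ a, p a * (w a / p a * ℓ a) ≤ if a ∈ G.actions h then w a * ℓ a else 0 := by
    intro a
    by_cases hpa : p a = 0
    · rw [hpa, zero_mul]
      split_ifs with ha
      · exact mul_nonneg (hw0 a) (meanLoss_mem hν hh hV hs ha).1
      · exact le_rfl
    · have ha : a ∈ G.actions h := by
        refine hpol ((PMF.mem_support_iff _ _).2 fun h0 => hpa ?_)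
        simp [hp, h0]
      rw [if_pos ha]
      exact le_of_eq (by field_simp)
  calc expect st.policy (fun a => w a / p a * ℓ a) = ∑ a, p a * (w a / p a * ℓ a) := rfl
    _ ≤ ∑ a, if a ∈ G.actions h then w a * ℓ a else 0 := Finset.sum_le_sum fun a _ => hsub a
    _ = T := by rw [Finset.sum_ite_mem, Finset.univ_inter]

end MeanLoss

section Deviation

variable {S A B : Type*} {H : ℕ} [Fintype A] [DecidableEq A]

theorem BanditState.policy_support_update {X : Finset A} {hX : X.Nonempty} {δ' : ℝ} {a : A}
    {x : ℝ} {st : BanditState A} :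
    (st.update X hX δ' a x).policy.support ⊆ (X : Set A) := by
  unfold BanditState.update
  simp only
  split_ifs <;> exact ftrlPolicy_support

variable [DecidableEq S] {G : MarkovGame S A B H} {η ι δ' : ℝ}

/-- The data of a visited pair after one more episode. -/
theorem epochData_succ_visited {k : ℕ} {ω : History S A B H (k + 1)} {h : ℕ} (hh : h < H) {s : S}
    (hs : s = (ω (Fin.last k) ⟨h, hh⟩).1) :
    epochData G η ι δ' (k + 1) ω h s =
      (epochData G η ι δ' k (fun i => ω i.castSucc) h s).update H h (G.actions h)
        (G.actions_nonempty h) η ι δ' (ω (Fin.last k) ⟨h, hh⟩).2.1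
        (G.reward h s (ω (Fin.last k) ⟨h, hh⟩).2.1 (ω (Fin.last k) ⟨h, hh⟩).2.2)
        (nextVal (fun s' => (epochData G η ι δ' k (fun i => ω i.castSucc) (h + 1) s').V) h
          (ω (Fin.last k))) := by
  subst hs
  simp only [epochData, epochStep, hh, dif_pos, observed, if_true, nextVal]

theorem epochData_succ_not_visited {k : ℕ} {ω : History S A B H (k + 1)} {h : ℕ} (hh : h < H)
    {s : S} (hs : s ≠ (ω (Fin.last k) ⟨h, hh⟩).1) :
    epochData G η ι δ' (k + 1) ω h s = epochData G η ι δ' k (fun i => ω i.castSucc) h s := by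
  simp only [epochData, epochStep, hh, dif_pos, observed]
  exact if_neg hs

theorem policy_support_epochData : ∀ (k : ℕ) (ω : History S A B H k) (h : ℕ) (s : S),
    (epochData G η ι δ' k ω h s).bandit.policy.support ⊆ (G.actions h : Set A)
  | 0, _, h, s => BanditState.policy_support_fresh
  | k + 1, ω, h, s => by
    have ih := policy_support_epochData k (fun i => ω i.castSucc) h s
    by_cases hh : h < H
    · by_cases hs : s = (ω (Fin.last k) ⟨h, hh⟩).1
      · rw [epochData_succ_visited hh hs]
        unfold EpochState.update
        simp only
        split_ifs
        · exact BanditState.policy_support_fresh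
        · exact BanditState.policy_support_update
      · rwa [epochData_succ_not_visited hh hs]
    · simpa only [epochData, epochStep, hh, dif_neg, not_false_eq_true] using ih

/-- The policies that Epoch V-learning commits to. -/
def epochLearner (G : MarkovGame S A B H) (η ι δ' : ℝ) (k : ℕ) (ω : History S A B H k) :
    Policy S A :=
  fun h s => (epochData G η ι δ' k ω h s).bandit.policy

theorem isLearnerPolicy_epochLearner (k : ℕ) (ω : History S A B H k) :
    G.IsLearnerPolicy (epochLearner G η ι δ' k ω) :=
  fun h _ s _ => policy_support_epochData k ω h s

variable {opponent : (k : ℕ) → History S A B H k → Policy S B}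
  {initial : (k : ℕ) → History S A B H k → PMF S} {ν : Policy S B}

theorem V_mem_epochData (hν : G.IsOppPolicy ν)
    (h₀ : ∀ k ω, (initial k ω).support ⊆ (G.states 0 : Set S)) : ∀ (k : ℕ) (ω : History S A B H k),
    ω ∈ (interactionLaw G (epochLearner G η ι δ') (fun _ _ => ν) initial k).support →
      ∀ h < H, ∀ s ∈ G.states h, 0 ≤ (epochData G η ι δ' k ω h s).total ∧
        (epochData G η ι δ' k ω h s).V ∈ Set.Icc (0 : ℝ) (H - h)
  | 0, ω, _, h, hh, s, hs => by
    have : (h : ℝ) ≤ H := by exact_mod_cast hh.le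
    simp only [epochData, epochInit]
    exact ⟨le_rfl, by linarith, le_rfl⟩
  | k + 1, ω, hω, h, hh, s, hs => by
    obtain ⟨hω', hleg⟩ := mem_support_interactionLaw_succ isLearnerPolicy_epochLearner
      (fun _ _ => hν) h₀ hω
    have ih := V_mem_epochData hν h₀ k _ hω'
    have hh' : (h : ℝ) ≤ H := by exact_mod_cast hh.le
    by_cases hvis : s = (ω (Fin.last k) ⟨h, hh⟩).1
    · rw [epochData_succ_visited hh hvis]
      have hx := reward_add_nextVal_mem hleg hh
        (V := fun s' => (epochData G η ι δ' k (fun i => ω i.castSucc) (h + 1) s').V)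
        fun hn s hs => (ih (h + 1) hn s hs).2
      rw [← hvis] at hx
      have htot := add_nonneg (ih h hh s hs).1 hx.1
      unfold EpochState.update
      simp only
      split_ifs
      · refine ⟨le_rfl, le_min (by linarith) ?_, min_le_left _ _⟩
        positivity
      · exact ⟨htot, (ih h hh s hs).2⟩
    · rw [epochData_succ_not_visited hh hvis]
      exact ih h hh s hs

variable [Fintype S] [Fintype B]

/-- The weighted deviation of the loss estimates from the mean losses, accumulated over the block
of the last visit to `(h, s)`. It is reset at the first visit of a block rather than at the
end of the previous one, so that after the last visit of a block it refers to the whole block. -/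
def deviation (G : MarkovGame S A B H) (ν : Policy S B) (η ι δ' : ℝ) (h : ℕ) (hh : h < H) (s : S) :
    (k : ℕ) → History S A B H k → ℝ
  | 0, _ => 0
  | k + 1, ω =>
    let c := epochData G η ι δ' k fun i => ω i.castSucc
    let e := ω (Fin.last k)
    if s = (e ⟨h, hh⟩).1 then
      (if (c h s).bandit.round = 0 then 0
        else deviation G ν η ι δ' h hh s k fun i => ω i.castSucc) +
        ixIncrement (G.actions h) δ' (G.optAction ν h s) (c h s).bandit (meanLoss G ν c h s)
          (e ⟨h, hh⟩).2.1
          ((G.reward h s (e ⟨h, hh⟩).2.1 (e ⟨h, hh⟩).2.2 +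
            nextVal (fun s' => (c (h + 1) s').V) h e) / H)
    else deviation G ν η ι δ' h hh s k fun i => ω i.castSucc

/-- Exponential moments of the deviations: each reset of `deviation` adds at most `1`. -/
theorem expect_exp_deviation_le (hν : G.IsOppPolicy ν)
    (h₀ : ∀ k ω, (initial k ω).support ⊆ (G.states 0 : Set S)) {h : ℕ} (hh : h < H) {s : S} :
    ∀ k : ℕ, expect (interactionLaw G (epochLearner G η ι δ') (fun _ _ => ν) initial k)
      (fun ω => Real.exp (deviation G ν η ι δ' h hh s k ω)) ≤ k + 1
  | 0 => by simp [deviation, expect_const]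
  | k + 1 => by
    have ih := expect_exp_deviation_le hν h₀ hh (s := s) k
    have hstep := expect_interactionLaw_succ_le (learner := epochLearner G η ι δ')
      (opponent := fun _ _ => ν) h₀ k
      (f := fun ω => Real.exp (deviation G ν η ι δ' h hh s (k + 1) ω))
      (g := fun ω => Real.exp (deviation G ν η ι δ' h hh s k ω) + 1) ?_
    · rw [expect_add, expect_const] at hstep
      push_cast
      linarith
    intro ω hω s₁ hs₁
    have hV : ∀ h < H, ∀ s ∈ G.states h, _ := fun h hh s hs =>
      (V_mem_epochData hν h₀ k ω hω h hh s hs).2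
    simp only [deviation, snoc_init, Fin.snoc_last]
    set D := deviation G ν η ι δ' h hh s k ω
    set c := epochData G η ι δ' k ω with hc
    set D' := if (c h s).bandit.round = 0 then 0 else D with hD'
    refine expect_episode_le (isLearnerPolicy_epochLearner k ω) hν hh hs₁
      (fun s' a b v => Real.exp (if s = s' then D' + ixIncrement (G.actions h) δ'
        (G.optAction ν h s) (c h s).bandit (meanLoss G ν c h s) a ((G.reward h s a b + v) / H)
        else D)) (fun s' => (c (h + 1) s').V) _ fun s' hs' => ?_
    by_cases hss : s = s'
    · subst hss
      simp only [if_true, Real.exp_add, expect_const_mul]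
      have h1 := expect_exp_ixIncrement_le (δ' := δ') hν hh hV hs'
        (policy_support_epochData k ω h s) (G.optAction ν h s)
      refine (mul_le_of_le_one_right (Real.exp_pos D').le h1).trans ?_
      rw [hD']
      split_ifs
      · rw [Real.exp_zero]
        linarith [Real.exp_pos D]
      · linarith
    · simp only [if_neg hss, expect_const]
      linarith

/-- The sum of the exponential deviations over all steps, states and episodes. -/
def deviationSum (G : MarkovGame S A B H) (ν : Policy S B) (η ι δ' : ℝ) :
    (k : ℕ) → History S A B H k → ℝ
  | 0, _ => 0
  | k + 1, ω => deviationSum G ν η ι δ' k (fun i => ω i.castSucc) +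
      ∑ h : Fin H, ∑ s ∈ G.states h, Real.exp (deviation G ν η ι δ' h h.2 s (k + 1) ω)

theorem deviationSum_nonneg : ∀ (k : ℕ) (ω : History S A B H k),
    0 ≤ deviationSum G ν η ι δ' k ω
  | 0, _ => le_rfl
  | k + 1, _ => add_nonneg (deviationSum_nonneg k _)
      (Finset.sum_nonneg fun _ _ => Finset.sum_nonneg fun _ _ => (Real.exp_pos _).le)

theorem expect_deviationSum_le (hν : G.IsOppPolicy ν)
    (h₀ : ∀ k ω, (initial k ω).support ⊆ (G.states 0 : Set S)) (K : ℕ) : ∀ k ≤ K,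
    expect (interactionLaw G (epochLearner G η ι δ') (fun _ _ => ν) initial k)
      (deviationSum G ν η ι δ' k) ≤ k * (H * (G.numStates * (K + 1)))
  | 0, _ => by
    simp only [deviationSum, expect_const]
    simp
  | k + 1, hk => by
    have ih := expect_deviationSum_le hν h₀ K k (by omega)
    simp only [deviationSum, expect_add, expect_sum]
    rw [expect_interactionLaw_init]
    have hk' : ((k + 1 : ℕ) : ℝ) ≤ K := by exact_mod_cast hk
    have h1 : ∀ h : Fin H, ∑ s ∈ G.states h,
        expect (interactionLaw G (epochLearner G η ι δ') (fun _ _ => ν) initial (k + 1))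
          (fun ω => Real.exp (deviation G ν η ι δ' h h.2 s (k + 1) ω)) ≤
            G.numStates * (K + 1) := by
      intro h
      have hcard : ((G.states h).card : ℝ) ≤ G.numStates := by
        exact_mod_cast card_states_le h.2.le
      calc _ ≤ ∑ s ∈ G.states h, ((K : ℝ) + 1) := Finset.sum_le_sum fun s _ =>
            (expect_exp_deviation_le hν h₀ h.2 (k + 1)).trans (by linarith)
        _ = (G.states h).card * (K + 1) := by rw [Finset.sum_const, nsmul_eq_mul]
        _ ≤ G.numStates * (K + 1) := by gcongr
    have h2 := Finset.sum_le_sum fun h (_ : h ∈ (Finset.univ : Finset (Fin H))) => h1 h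
    rw [Finset.sum_const, nsmul_eq_mul, Finset.card_univ, Fintype.card_fin] at h2
    push_cast
    linarith

end Deviation

/-! ### The regret bound on the good event -/

section RunSum

variable {S A B : Type*} {H : ℕ}

theorem runSum_add (f g : (k : ℕ) → History S A B H k → Episode S A B H → ℝ) :
    ∀ (k : ℕ) (ω : History S A B H k),
      runSum (fun k ω e => f k ω e + g k ω e) k ω = runSum f k ω + runSum g k ω
  | 0, _ => by simp [runSum]
  | k + 1, ω => by
    simp only [runSum, runSum_add f g k]
    ring

theorem runSum_mul (c : ℝ) (f : (k : ℕ) → History S A B H k → Episode S A B H → ℝ) :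
    ∀ (k : ℕ) (ω : History S A B H k), runSum (fun k ω e => c * f k ω e) k ω = c * runSum f k ω
  | 0, _ => by simp [runSum]
  | k + 1, ω => by
    simp only [runSum, runSum_mul c f k]
    ring

theorem runSum_const (c : ℝ) : ∀ (k : ℕ) (ω : History S A B H k),
    runSum (fun _ _ _ => c) k ω = k * c
  | 0, _ => by simp [runSum]
  | k + 1, ω => by
    simp only [runSum, runSum_const c k]
    push_cast
    ring

theorem runSum_sum {κ : Type*} (t : Finset κ)
    (f : κ → (k : ℕ) → History S A B H k → Episode S A B H → ℝ) :
    ∀ (k : ℕ) (ω : History S A B H k),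
      runSum (fun k ω e => ∑ i ∈ t, f i k ω e) k ω = ∑ i ∈ t, runSum (f i) k ω
  | 0, _ => by simp [runSum]
  | k + 1, ω => by simp only [runSum, runSum_sum t f k, Finset.sum_add_distrib]

theorem runSum_mono {G : MarkovGame S A B H} {P : (k : ℕ) → History S A B H k → Prop}
    (hP : ∀ k ω, P (k + 1) ω → P k (fun i => ω i.castSucc) ∧ G.Legal (ω (Fin.last k)))
    {f g : (k : ℕ) → History S A B H k → Episode S A B H → ℝ}
    (hfg : ∀ k ω e, P k ω → G.Legal e → f k ω e ≤ g k ω e) :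
    ∀ (k : ℕ) (ω : History S A B H k), P k ω → runSum f k ω ≤ runSum g k ω
  | 0, _, _ => le_rfl
  | k + 1, ω, hω => by
    obtain ⟨h1, h2⟩ := hP k ω hω
    exact add_le_add (runSum_mono hP hfg k _ h1) (hfg k _ _ h1 h2)

/-- A recursion with growth factor `1 + 1 / H` over `H` steps loses only a constant factor. -/
theorem le_of_backward_recursion (hH : 0 < H) {D : ℕ → ℝ} {Z : ℝ} (hZ : 0 ≤ Z) (hD : D H = 0)
    (hstep : ∀ h < H, D h ≤ (1 + 1 / (H : ℝ)) * (D (h + 1) + Z)) : D 0 ≤ 3 * H * Z := by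
  have hH' : (0 : ℝ) < H := by exact_mod_cast hH
  have key : ∀ n ≤ H, D (H - n) ≤ n * (1 + 1 / (H : ℝ)) ^ n * Z := by
    intro n
    induction n with
    | zero => simp [hD]
    | succ n ih =>
      intro hn
      have h1 := hstep (H - (n + 1)) (by omega)
      rw [show H - (n + 1) + 1 = H - n by omega] at h1
      have h2 := ih (by omega)
      have h3 : 1 ≤ (1 + 1 / (H : ℝ)) ^ n := one_le_pow₀ (by
        have : 0 < 1 / (H : ℝ) := by positivity
        linarith)
      calc D (H - (n + 1)) ≤ (1 + 1 / (H : ℝ)) * (D (H - n) + Z) := h1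
        _ ≤ (1 + 1 / (H : ℝ)) * (n * (1 + 1 / (H : ℝ)) ^ n * Z +
            (1 + 1 / (H : ℝ)) ^ n * Z) := by
          gcongr
          exact le_mul_of_one_le_left hZ h3
        _ = ((n + 1 : ℕ) : ℝ) * (1 + 1 / (H : ℝ)) ^ (n + 1) * Z := by
          push_cast
          ring
  have h1 := key H le_rfl
  rw [Nat.sub_self] at h1
  have h2 : (1 + 1 / (H : ℝ)) ^ H ≤ 3 := by
    calc (1 + 1 / (H : ℝ)) ^ H ≤ Real.exp (1 / H) ^ H := by
          refine pow_le_pow_left₀ (by positivity) ?_ H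
          linarith [Real.add_one_le_exp (1 / (H : ℝ))]
      _ = Real.exp 1 := by rw [← Real.exp_nat_mul, mul_one_div_cancel hH'.ne']
      _ ≤ 3 := by linarith [Real.exp_one_lt_d9]
  calc D 0 ≤ H * (1 + 1 / (H : ℝ)) ^ H * Z := h1
    _ ≤ H * 3 * Z := by gcongr
    _ = 3 * H * Z := by ring

end RunSum

section GoodEvent

variable {S A B : Type*} {H : ℕ} [Fintype A] [DecidableEq A] [DecidableEq S] [Fintype S]
  [Fintype B] {G : MarkovGame S A B H} {η ι δ' T : ℝ}
  {initial : (k : ℕ) → History S A B H k → PMF S} {ν : Policy S B}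

/-- The event, for the first `k` episodes, on which the bandit loss estimates are accurate. -/
def GoodHistory (G : MarkovGame S A B H) (ν : Policy S B)
    (initial : (k : ℕ) → History S A B H k → PMF S) (η ι δ' T : ℝ) (k : ℕ)
    (ω : History S A B H k) : Prop :=
  ω ∈ (interactionLaw G (epochLearner G η ι δ') (fun _ _ => ν) initial k).support ∧
    deviationSum G ν η ι δ' k ω ≤ T

theorem GoodHistory.init (hν : G.IsOppPolicy ν)
    (h₀ : ∀ k ω, (initial k ω).support ⊆ (G.states 0 : Set S)) (k : ℕ)
    (ω : History S A B H (k + 1)) (hω : GoodHistory G ν initial η ι δ' T (k + 1) ω) :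
    GoodHistory G ν initial η ι δ' T k (fun i => ω i.castSucc) ∧ G.Legal (ω (Fin.last k)) := by
  obtain ⟨h1, h2⟩ := mem_support_interactionLaw_succ isLearnerPolicy_epochLearner
    (fun _ _ => hν) h₀ hω.1
  refine ⟨⟨h1, le_trans ?_ hω.2⟩, h2⟩
  exact le_add_of_nonneg_right
    (Finset.sum_nonneg fun _ _ => Finset.sum_nonneg fun _ _ => (Real.exp_pos _).le)

theorem GoodHistory.deviation_le {k : ℕ} {ω : History S A B H (k + 1)}
    (hω : GoodHistory G ν initial η ι δ' T (k + 1) ω) {h : ℕ} (hh : h < H) {s : S}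
    (hs : s ∈ G.states h) : deviation G ν η ι δ' h hh s (k + 1) ω ≤ Real.log T := by
  have h1 : Real.exp (deviation G ν η ι δ' h hh s (k + 1) ω) ≤ T := by
    refine le_trans ?_ hω.2
    refine le_trans ?_ (le_add_of_nonneg_left (deviationSum_nonneg k _))
    refine le_trans ?_ (Finset.single_le_sum (f := fun h : Fin H =>
      ∑ s ∈ G.states h, Real.exp (deviation G ν η ι δ' h h.2 s (k + 1) ω))
      (fun _ _ => Finset.sum_nonneg fun _ _ => (Real.exp_pos _).le) (Finset.mem_univ ⟨h, hh⟩))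
    exact Finset.single_le_sum (f := fun s =>
      Real.exp (deviation G ν η ι δ' h hh s (k + 1) ω)) (fun _ _ => (Real.exp_pos _).le) hs
  exact (Real.le_log_iff_exp_le ((Real.exp_pos _).trans_le h1)).2 h1

/-- The requirements on the confidence parameters: the good event has deviations at most
`2 log (|A_h| / δ')`, and the bonus exceeds the resulting bandit regret. -/
structure ConfidenceParams (G : MarkovGame S A B H) (ι δ' T : ℝ) : Prop where
  one_le_log : ∀ h < H, 1 ≤ Real.log ((G.actions h).card / δ')
  log_le : ∀ h < H, Real.log T ≤ 2 * Real.log ((G.actions h).card / δ')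
  width_le : ∀ h < H,
    25 * (H * √((G.actions h).card * Real.log ((G.actions h).card / δ'))) ≤ √ι

/-- On the good event the estimates of Epoch V-learning are optimistic. -/
theorem GoodHistory.visitInv (hν : G.IsOppPolicy ν)
    (h₀ : ∀ k ω, (initial k ω).support ⊆ (G.states 0 : Set S))
    (hpar : ConfidenceParams G ι δ' T) : ∀ (k : ℕ) (ω : History S A B H k),
    GoodHistory G ν initial η ι δ' T k ω → ∀ (h : ℕ) (hh : h < H), ∀ s ∈ G.states h,
      VisitInv (G.actions h) (G.actions_nonempty h) H δ' ι (G.optAction ν h s)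
        (G.optValue ν h s) (deviation G ν η ι δ' h hh s k ω) (epochData G η ι δ' k ω h s)
  | 0, _, _, h, hh, s, hs => visitInv_fresh (MarkovGame.optValue_le hν hh hs)
  | k + 1, ω, hω, h, hh, s, hs => by
    obtain ⟨hω', hleg⟩ := GoodHistory.init hν h₀ k ω hω
    have ih := GoodHistory.visitInv hν h₀ hpar k _ hω'
    have hV : ∀ h < H, ∀ s ∈ G.states h, _ := fun h hh s hs =>
      (V_mem_epochData hν h₀ k _ hω'.1 h hh s hs).2
    by_cases hvis : s = (ω (Fin.last k) ⟨h, hh⟩).1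
    · have hx := reward_add_nextVal_mem hleg hh
        (V := fun s' => (epochData G η ι δ' k (fun i => ω i.castSucc) (h + 1) s').V)
        fun hn s hs => hV (h + 1) hn s hs
      rw [← hvis] at hx
      rw [epochData_succ_visited hh hvis]
      refine (ih h hh s hs).update (Nat.zero_lt_of_lt hh) (G.optAction_mem ν h s)
        (hpar.one_le_log h hh) (hpar.width_le h hh) (MarkovGame.optValue_le hν hh hs)
        (hleg ⟨h, hh⟩).2.1 hx
        (fun a ha => meanLoss_mem hν hh hV hs ha) ?_ ?_
        ((hω.deviation_le hh hs).trans (hpar.log_le h hh))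
      · rw [meanLoss, MarkovGame.optValue_eq_qVal hh]
        refine sub_le_sub_left (div_le_div_of_nonneg_right ?_ (Nat.cast_nonneg H)) 1
        refine MarkovGame.qVal_mono hν hh (fun s' hs' => ?_) hs (G.optAction_mem ν h s)
        unfold nextEst
        split_ifs with hn
        · exact (ih (h + 1) hn s' hs').le_V
        · obtain rfl : H = h + 1 := by omega
          rw [MarkovGame.optValue_terminal]
      · simp only [deviation, if_pos hvis]
    · rw [epochData_succ_not_visited hh hvis]
      simp only [deviation, if_neg hvis]
      exact ih h hh s hs

/-- The one-visit loss of the estimate at the state of step `h` of an episode, less the part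
`φ / (H + 1) + √ι θ / 2` that is accounted for separately, where `φ` is the excess of the
estimate over the optimal value. -/
def stepExcess (G : MarkovGame S A B H) (ν : Policy S B) (η ι δ' θ : ℝ) (h : ℕ) (hh : h < H)
    (k : ℕ) (ω : History S A B H k) (e : Episode S A B H) : ℝ :=
  let c := epochData G η ι δ' k ω
  let s := (e ⟨h, hh⟩).1
  (c h s).V - (G.reward h s (e ⟨h, hh⟩).2.1 (e ⟨h, hh⟩).2.2 +
      nextVal (fun s' => (c (h + 1) s').V) h e) -
    ((c h s).V - G.optValue ν h s) / (H + 1) - √ι * θ / 2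

theorem GoodHistory.epochInv (hν : G.IsOppPolicy ν)
    (h₀ : ∀ k ω, (initial k ω).support ⊆ (G.states 0 : Set S))
    (hpar : ConfidenceParams G ι δ' T) {θ : ℝ} (hθ : 0 < θ) {h : ℕ} (hh : h < H) {s : S}
    (hs : s ∈ G.states h) : ∀ (k : ℕ) (ω : History S A B H k),
    GoodHistory G ν initial (1 / H) ι δ' T k ω →
      EpochInv H ι θ (G.optValue ν h s) k
        (runSum (fun k ω e => if s = (e ⟨h, hh⟩).1 then
          stepExcess G ν (1 / H) ι δ' θ h hh k ω e else 0) k ω)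
        (epochData G (1 / H) ι δ' k ω h s)
  | 0, _, _ => by
    refine epochInv_init (MarkovGame.optValue_mem hν (H - h) h (by omega) s hs).1 ?_ _
    linarith [(Nat.cast_nonneg h : (0 : ℝ) ≤ h)]
  | k + 1, ω, hω => by
    obtain ⟨hω', hleg⟩ := GoodHistory.init hν h₀ k ω hω
    have ih := GoodHistory.epochInv hν h₀ hpar hθ hh hs k _ hω'
    by_cases hvis : s = (ω (Fin.last k) ⟨h, hh⟩).1
    · rw [epochData_succ_visited hh hvis]
      simp only [runSum, if_pos hvis, stepExcess]
      rw [← hvis]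
      refine ih.update (Nat.zero_lt_of_lt hh) hθ
        (MarkovGame.optValue_mem hν (H - h) h (by omega) s hs).1
        (GoodHistory.visitInv hν h₀ hpar k _ hω' h hh s hs).le_V ?_ _ _ _
      have := (V_mem_epochData hν h₀ k _ hω'.1 h hh s hs).2.2
      linarith [(Nat.cast_nonneg h : (0 : ℝ) ≤ h)]
    · rw [epochData_succ_not_visited hh hvis]
      simp only [runSum, if_neg hvis, add_zero]
      exact ih.mono (Nat.le_succ k)

theorem GoodHistory.runSum_stepExcess_le (hν : G.IsOppPolicy ν)
    (h₀ : ∀ k ω, (initial k ω).support ⊆ (G.states 0 : Set S))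
    (hpar : ConfidenceParams G ι δ' T) {θ : ℝ} (hθ : 0 < θ) {h : ℕ} (hh : h < H) {K : ℕ}
    (hK : 1 ≤ K) {ω : History S A B H K} (hω : GoodHistory G ν initial (1 / H) ι δ' T K ω) :
    runSum (stepExcess G ν (1 / H) ι δ' θ h hh) K ω ≤
      G.numStates * ((H + √ι / (2 * θ)) * (1 + (H + 1) * Real.log K)) := by
  have h1 : runSum (stepExcess G ν (1 / H) ι δ' θ h hh) K ω ≤
      runSum (fun k ω e => ∑ s ∈ G.states h, if s = (e ⟨h, hh⟩).1 then
        stepExcess G ν (1 / H) ι δ' θ h hh k ω e else 0) K ω := by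
    refine runSum_mono (GoodHistory.init hν h₀) (fun k ω e _ he => ?_) K ω hω
    rw [Finset.sum_ite_eq', if_pos (he ⟨h, hh⟩).1]
  have hlog : 0 ≤ Real.log K := Real.log_natCast_nonneg K
  rw [runSum_sum] at h1
  refine h1.trans ?_
  calc _ ≤ ∑ s ∈ G.states h, (H + √ι / (2 * θ)) * (1 + (H + 1) * Real.log K) := by
        refine Finset.sum_le_sum fun s hs => ?_
        have hv := GoodHistory.visitInv hν h₀ hpar K _ hω h hh s hs
        exact (GoodHistory.epochInv hν h₀ hpar hθ hh hs K ω hω).sum_le (Nat.zero_lt_of_lt hh) hθ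
          hK hv.le_V hv.shortfall_le
    _ = (G.states h).card * ((H + √ι / (2 * θ)) * (1 + (H + 1) * Real.log K)) := by
        rw [Finset.sum_const, nsmul_eq_mul]
    _ ≤ G.numStates * ((H + √ι / (2 * θ)) * (1 + (H + 1) * Real.log K)) := by
        have : ((G.states h).card : ℝ) ≤ G.numStates := by exact_mod_cast card_states_le hh.le
        gcongr

/-- The excess of the estimate over the value of the policies played, at the state of step `h` of
an episode. -/
def valueGap (G : MarkovGame S A B H) (ν : Policy S B) (η ι δ' : ℝ) (h k : ℕ)
    (ω : History S A B H k) (e : Episode S A B H) : ℝ :=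
  if hh : h < H then (epochData G η ι δ' k ω h (e ⟨h, hh⟩).1).V -
    G.value (epochLearner G η ι δ' k ω) ν h (e ⟨h, hh⟩).1 else 0

theorem valueGap_le (hν : G.IsOppPolicy ν) {θ : ℝ} {h : ℕ} (hh : h < H) (k : ℕ)
    (ω : History S A B H k) {e : Episode S A B H} (he : G.Legal e) :
    (H : ℝ) / (H + 1) * valueGap G ν η ι δ' h k ω e ≤ valueGap G ν η ι δ' (h + 1) k ω e +
      (stepExcess G ν η ι δ' θ h hh k ω e +
        (√ι * θ / 2 + valueNoise G ν (epochLearner G η ι δ') h k ω e)) := by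
  have hnext : valueGap G ν η ι δ' (h + 1) k ω e =
      nextVal (fun s' => (epochData G η ι δ' k ω (h + 1) s').V) h e -
        nextVal (G.value (epochLearner G η ι δ' k ω) ν (h + 1)) h e := by
    unfold valueGap nextVal
    split_ifs <;> simp
  have hle := MarkovGame.value_le_optValue (isLearnerPolicy_epochLearner (η := η) (ι := ι)
    (δ' := δ') k ω) hν (H - h) h (by omega) _ (he ⟨h, hh⟩).1
  rw [hnext]
  simp only [valueGap, valueNoise, stepExcess, hh, dif_pos]
  set V := (epochData G η ι δ' k ω h (e ⟨h, hh⟩).1).V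
  set W := G.value (epochLearner G η ι δ' k ω) ν h (e ⟨h, hh⟩).1
  set O := G.optValue ν h (e ⟨h, hh⟩).1
  have hH1 : (0 : ℝ) < H + 1 := by positivity
  have e1 : (H : ℝ) / (H + 1) * (V - W) = (V - W) - (V - W) / (H + 1) := by
    field_simp
    ring
  have e2 : (V - O) / (H + 1) ≤ (V - W) / (H + 1) := by
    gcongr
  rw [e1]
  linarith

/-- On the good event, the regret is controlled by the temporal-difference errors of the values
of the played policies. -/
theorem GoodHistory.regret_le (hν : G.IsOppPolicy ν)
    (h₀ : ∀ k ω, (initial k ω).support ⊆ (G.states 0 : Set S))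
    (hpar : ConfidenceParams G ι δ' T) {θ : ℝ} (hθ : 0 < θ) {K : ℕ} (hK : 1 ≤ K) (hH : 0 < H)
    {ω : History S A B H K} (hω : GoodHistory G ν initial (1 / H) ι δ' T K ω) {M : ℝ} (hM0 : 0 ≤ M)
    (hM : ∀ h < H, runSum (valueNoise G ν (epochLearner G (1 / H) ι δ') h) K ω ≤ M) :
    runSum (fun k ω e => G.optValue ν 0 (e ⟨0, hH⟩).1 -
        G.value (epochLearner G (1 / H) ι δ' k ω) ν 0 (e ⟨0, hH⟩).1) K ω ≤
      3 * H * (G.numStates * ((H + √ι / (2 * θ)) * (1 + (H + 1) * Real.log K)) +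
        (K * (√ι * θ / 2) + M)) := by
  have hH' : (0 : ℝ) < H := by exact_mod_cast hH
  have hlog : 0 ≤ Real.log K := Real.log_natCast_nonneg K
  have hopt : runSum (fun k ω e => G.optValue ν 0 (e ⟨0, hH⟩).1 -
        G.value (epochLearner G (1 / H) ι δ' k ω) ν 0 (e ⟨0, hH⟩).1) K ω ≤
      runSum (valueGap G ν (1 / H) ι δ' 0) K ω := by
    refine runSum_mono (GoodHistory.init hν h₀) (fun k ω e hω he => ?_) K ω hω
    simp only [valueGap, hH, dif_pos]
    exact sub_le_sub_right
      (GoodHistory.visitInv hν h₀ hpar k ω hω 0 hH _ (he ⟨0, hH⟩).1).le_V _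
  refine hopt.trans ?_
  refine le_of_backward_recursion (D := fun h => runSum (valueGap G ν (1 / H) ι δ' h) K ω) hH
    (by positivity) ?_ fun h hh => ?_
  · have : valueGap G ν (1 / H) ι δ' H = fun _ _ _ => 0 := by
      funext k ω e
      simp [valueGap]
    simp only [this, runSum_const, mul_zero]
  · have h1 := runSum_mono (GoodHistory.init hν h₀) (fun k ω e _ he =>
      valueGap_le (ι := ι) (δ' := δ') (η := 1 / H) hν (θ := θ) hh k ω he) K ω hω
    rw [runSum_mul, runSum_add, runSum_add, runSum_add, runSum_const] at h1
    have h2 := GoodHistory.runSum_stepExcess_le hν h₀ hpar hθ hh hK hω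
    have h3 := hM h hh
    set D := runSum (valueGap G ν (1 / H) ι δ' h) K ω
    have h4 : D = (1 + 1 / (H : ℝ)) * ((H : ℝ) / (H + 1) * D) := by
      field_simp
    rw [h4]
    gcongr
    linarith

end GoodEvent

/-! ### The final bound -/

theorem regret_arithmetic {H S A K Λ ι lK c₁ : ℝ} (hH : 1 ≤ H) (hS : 1 ≤ S) (hA : 1 ≤ A)
    (hΛ : 1 ≤ Λ) (hl : lK ≤ Λ) (hKS : H * S ≤ K) (hc : 0 ≤ c₁)
    (hι : ι ≤ c₁ * (H ^ 2 * A * Λ)) :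
    3 * H * (S * ((H + √ι / (2 * √(H * S * Λ / K))) * (1 + (H + 1) * lK)) +
        (K * (√ι * √(H * S * Λ / K) / 2) + 2 * H * √(K * Λ))) ≤
      (15 + 6 * √c₁) * √(H ^ 5 * A * S * K) * Λ := by
  have hK : 1 ≤ K := le_trans (by nlinarith) hKS
  set θ := √(H * S * Λ / K) with hθd
  have hθ : 0 < θ := Real.sqrt_pos.2 (by positivity)
  have hθ2 : K * (θ * θ) = H * S * Λ := by
    rw [hθd, Real.mul_self_sqrt (by positivity)]
    field_simp
  set Q := √(H ^ 5 * A * S * K) with hQ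
  have hfac : 1 + (H + 1) * lK ≤ 3 * H * Λ := by
    nlinarith [mul_le_mul hH hΛ zero_le_one (by linarith)]
  have hfirst : S * ((H + √ι / (2 * θ)) * (1 + (H + 1) * lK)) ≤
      3 * (S * H ^ 2 * Λ) + 3 / 2 * (√ι * (K * θ)) := by
    calc S * ((H + √ι / (2 * θ)) * (1 + (H + 1) * lK)) ≤
          S * ((H + √ι / (2 * θ)) * (3 * H * Λ)) := by gcongr
      _ = 3 * (S * H ^ 2 * Λ) + 3 / 2 * (√ι * ((H * S * Λ) / θ)) := by
          field_simp
      _ = 3 * (S * H ^ 2 * Λ) + 3 / 2 * (√ι * (K * θ)) := by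
          rw [← hθ2]
          field_simp
  have hKθ : K * θ = √(H * S * Λ * K) := by
    have e : H * S * Λ * K = (K * θ) ^ 2 := by
      rw [← hθ2]
      ring
    rw [e, Real.sqrt_sq (by positivity)]
  have hwidth : H ^ 2 * (√ι * (K * θ)) ≤ √c₁ * H * Q * Λ := by
    have h1 : √ι * (K * θ) ≤ √c₁ * (√(H ^ 2 * A * Λ) * √(H * S * Λ * K)) := by
      rw [hKθ, ← mul_assoc, ← Real.sqrt_mul hc]
      gcongr
    have h2 : H * (√(H ^ 2 * A * Λ) * √(H * S * Λ * K)) = Q * Λ := by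
      rw [← Real.sqrt_mul (by positivity), hQ]
      have e : H ^ 2 * A * Λ * (H * S * Λ * K) = (H ^ 3 * A * S * K) * Λ ^ 2 := by ring
      have e' : H ^ 5 * A * S * K = (H ^ 3 * A * S * K) * H ^ 2 := by ring
      rw [e, e', Real.sqrt_mul (by positivity) (Λ ^ 2), Real.sqrt_sq (by linarith),
        Real.sqrt_mul (by positivity) (H ^ 2), Real.sqrt_sq (by linarith)]
      ring
    calc H ^ 2 * (√ι * (K * θ)) ≤
          H ^ 2 * (√c₁ * (√(H ^ 2 * A * Λ) * √(H * S * Λ * K))) := by gcongr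
      _ = √c₁ * H * (H * (√(H ^ 2 * A * Λ) * √(H * S * Λ * K))) := by ring
      _ = √c₁ * H * Q * Λ := by
        rw [h2]
        ring
  have hwidth' : H * (√ι * (K * θ)) ≤ √c₁ * Q * Λ := by
    have h1 : H * (H * (√ι * (K * θ))) ≤ H * (√c₁ * Q * Λ) := by linarith
    exact le_of_mul_le_mul_left h1 (by linarith)
  have hstates : S * H ^ 3 ≤ Q := by
    refine Real.le_sqrt_of_sq_le ?_
    calc (S * H ^ 3) ^ 2 = H ^ 5 * 1 * S * (H * S) := by ring
      _ ≤ H ^ 5 * A * S * K := by gcongr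
  have hnoise : H ^ 2 * √(K * Λ) ≤ Q * Λ := by
    have h1 : H ^ 2 * √K ≤ Q := by
      have e : H ^ 2 * √K = √(H ^ 4 * K) := by
        rw [Real.sqrt_mul (by positivity), show H ^ 4 = (H ^ 2) ^ 2 by ring,
          Real.sqrt_sq (by positivity)]
      rw [e, hQ]
      refine Real.sqrt_le_sqrt ?_
      calc H ^ 4 * K = H ^ 4 * 1 * 1 * K := by ring
        _ ≤ H ^ 5 * A * S * K := by
          have : H ^ 4 ≤ H ^ 5 := pow_le_pow_right₀ hH (by norm_num)
          gcongr
    have h2 : √Λ ≤ Λ := Real.sqrt_le_iff.2 ⟨by linarith, by nlinarith⟩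
    calc H ^ 2 * √(K * Λ) = H ^ 2 * √K * √Λ := by rw [Real.sqrt_mul (by linarith)]; ring
      _ ≤ Q * Λ := by gcongr
  calc 3 * H * (S * ((H + √ι / (2 * θ)) * (1 + (H + 1) * lK)) +
        (K * (√ι * θ / 2) + 2 * H * √(K * Λ))) ≤
      3 * H * (3 * (S * H ^ 2 * Λ) + 3 / 2 * (√ι * (K * θ)) +
        (K * (√ι * θ / 2) + 2 * H * √(K * Λ))) := by gcongr
    _ = 9 * (S * H ^ 3 * Λ) + 6 * (H * (√ι * (K * θ))) + 6 * (H ^ 2 * √(K * Λ)) := by ring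
    _ ≤ 9 * (Q * Λ) + 6 * (√c₁ * Q * Λ) + 6 * (Q * Λ) := by gcongr
    _ = (15 + 6 * √c₁) * Q * Λ := by ring

/-- For few episodes the trivial bound `H K` on the regret suffices. -/
theorem trivial_arithmetic {H S A K Λ : ℝ} (hH : 1 ≤ H) (hS : 1 ≤ S) (hA : 1 ≤ A) (hK : 1 ≤ K)
    (hΛ : 1 ≤ Λ) (h : K < H * S ∨ K < Λ) : K * H ≤ √(H ^ 5 * A * S * K) * Λ := by
  set Q := √(H ^ 5 * A * S * K) with hQ
  rcases h with h | h
  · have h1 : K * H ≤ Q := by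
      refine Real.le_sqrt_of_sq_le ?_
      calc (K * H) ^ 2 = H ^ 2 * 1 * K * K := by ring
        _ ≤ H ^ 2 * A * K * (H * S) := by gcongr
        _ = H ^ 3 * A * S * K := by ring
        _ ≤ H ^ 5 * A * S * K := by
          have : H ^ 3 ≤ H ^ 5 := pow_le_pow_right₀ hH (by norm_num)
          gcongr
    exact h1.trans (le_mul_of_one_le_right (Real.sqrt_nonneg _) hΛ)
  · have h1 : H * √K ≤ Q := by
      have e : H * √K = √(H ^ 2 * K) := by
        rw [Real.sqrt_mul (by positivity), Real.sqrt_sq (by positivity)]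
      rw [e, hQ]
      refine Real.sqrt_le_sqrt ?_
      calc H ^ 2 * K = H ^ 2 * 1 * 1 * K := by ring
        _ ≤ H ^ 5 * A * S * K := by
          have : H ^ 2 ≤ H ^ 5 := pow_le_pow_right₀ hH (by norm_num)
          gcongr
    have h2 : √K ≤ Λ := (Real.sqrt_le_iff.2 ⟨by linarith, by nlinarith⟩ : √K ≤ K).trans h.le
    calc K * H = H * √K * √K := by
          rw [mul_assoc, Real.mul_self_sqrt (by linarith), mul_comm]
      _ ≤ Q * Λ := by gcongr

section Main

variable {S A B : Type*} {H : ℕ} {G : MarkovGame S A B H} {K : ℕ} {δ : ℝ}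

theorem one_le_numStates [DecidableEq S] : 1 ≤ G.numStates :=
  G.terminal_unique.ge.trans (card_states_le le_rfl)

theorem card_actions_le [DecidableEq A] {h : ℕ} (hh : h < H) :
    (G.actions h).card ≤ G.numActions :=
  Finset.card_le_card (Finset.subset_biUnion_of_mem G.actions (Finset.mem_range.2 hh))

theorem one_le_numActions [DecidableEq A] (hH : 0 < H) : 1 ≤ G.numActions :=
  (Finset.one_le_card.2 (G.actions_nonempty 0)).trans (card_actions_le hH)

variable [DecidableEq S] [DecidableEq A]

/-- The logarithm dominates that of every factor of its argument. -/
theorem log_le_logFactor (hH : 0 < H) (hK : 1 ≤ K) (hδ : 0 < δ) (hδ1 : δ < 1) {y : ℝ} (hy : 0 < y)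
    (h : y ≤ 8 * H * K * G.numActions * G.numStates) : Real.log y ≤ logFactor G K δ := by
  have hS : (1 : ℝ) ≤ G.numStates := by exact_mod_cast one_le_numStates
  have hA : (1 : ℝ) ≤ G.numActions := by exact_mod_cast one_le_numActions hH
  refine Real.log_le_log hy (h.trans ?_)
  exact le_div_self (by positivity) hδ hδ1.le

theorem one_le_logFactor (hH : 0 < H) (hK : 1 ≤ K) (hδ : 0 < δ) (hδ1 : δ < 1) :
    1 ≤ logFactor G K δ := by
  have hS : (1 : ℝ) ≤ G.numStates := by exact_mod_cast one_le_numStates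
  have hA : (1 : ℝ) ≤ G.numActions := by exact_mod_cast one_le_numActions hH
  have hH' : (1 : ℝ) ≤ H := by exact_mod_cast hH
  have hK' : (1 : ℝ) ≤ K := by exact_mod_cast hK
  have h1 : Real.log (Real.exp 1) ≤ logFactor G K δ := by
    refine log_le_logFactor hH hK hδ hδ1 (Real.exp_pos 1) ?_
    calc Real.exp 1 ≤ 8 * 1 * 1 * 1 * 1 := by linarith [Real.exp_one_lt_d9]
      _ ≤ 8 * H * K * G.numActions * G.numStates := by gcongr
  rwa [Real.log_exp] at h1

/-- The parameters of the statement meet the requirements of the analysis. -/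
theorem confidenceParams (hH : 0 < H) (hK : 1 ≤ K) (hδ : 0 < δ) (hδ1 : δ < 1) {ι : ℝ}
    (hι : 625 * (H ^ 2 * G.numActions * logFactor G K δ) ≤ ι) :
    ConfidenceParams G ι (δ / (4 * H * K * G.numStates))
      (4 * K ^ 2 * H * G.numStates / δ) := by
  have hS : (1 : ℝ) ≤ G.numStates := by exact_mod_cast one_le_numStates
  have hH' : (1 : ℝ) ≤ H := by exact_mod_cast hH
  have hK' : (1 : ℝ) ≤ K := by exact_mod_cast hK
  have hX : ∀ h, (1 : ℝ) ≤ (G.actions h).card := fun h => by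
    exact_mod_cast Finset.card_pos.2 (G.actions_nonempty h)
  have harg : ∀ h, ((G.actions h).card : ℝ) / (δ / (4 * H * K * G.numStates)) =
      4 * H * K * (G.actions h).card * G.numStates / δ := fun h => by
    field_simp
  have hlog : ∀ h, 1 ≤ Real.log ((G.actions h).card / (δ / (4 * H * K * G.numStates))) := by
    intro h
    have := hX h
    rw [harg, Real.le_log_iff_exp_le (by positivity)]
    calc Real.exp 1 ≤ 4 * 1 * 1 * 1 * 1 := by linarith [Real.exp_one_lt_d9]
      _ ≤ 4 * H * K * (G.actions h).card * G.numStates := by gcongr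
      _ ≤ _ := le_div_self (by positivity) hδ hδ1.le
  refine ⟨fun h _ => hlog h, fun h _ => ?_, fun h hh => ?_⟩
  · have := hX h
    have htwo : ∀ y : ℝ, 2 * Real.log y = Real.log (y ^ 2) := fun y => by
      rw [Real.log_pow, Nat.cast_ofNat]
    rw [harg, htwo]
    refine Real.log_le_log (by positivity) ?_
    have h1 : (1 : ℝ) ≤ 4 * H * (G.actions h).card ^ 2 * G.numStates := by
      calc (1 : ℝ) ≤ 4 * 1 * 1 ^ 2 * 1 := by norm_num
        _ ≤ _ := by gcongr
    have h2 : 1 ≤ 1 / δ := by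
      rw [le_div_iff₀ hδ]
      linarith
    calc 4 * K ^ 2 * H * G.numStates / δ = 4 * K ^ 2 * H * G.numStates / δ * (1 * 1) := by ring
      _ ≤ 4 * K ^ 2 * H * G.numStates / δ *
          (4 * H * (G.actions h).card ^ 2 * G.numStates * (1 / δ)) := by gcongr
      _ = _ := by ring
  · have hc : ((G.actions h).card : ℝ) ≤ G.numActions := by exact_mod_cast card_actions_le hh
    have h1 : Real.log ((G.actions h).card / (δ / (4 * H * K * G.numStates))) ≤
        logFactor G K δ := by
      have := hX h
      rw [harg]
      refine Real.log_le_log (by positivity) ?_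
      gcongr
      norm_num
    have h0 := hlog h
    refine Real.le_sqrt_of_sq_le (le_trans ?_ hι)
    rw [mul_pow, mul_pow, Real.sq_sqrt (mul_nonneg (by linarith [hX h]) (by linarith))]
    calc 25 ^ 2 * (H ^ 2 * ((G.actions h).card *
          Real.log ((G.actions h).card / (δ / (4 * H * K * G.numStates))))) ≤
        25 ^ 2 * ((H : ℝ) ^ 2 * (G.numActions * logFactor G K δ)) := by gcongr
      _ = 625 * (H ^ 2 * G.numActions * logFactor G K δ) := by ring

theorem initialStates_mem [NeZero H] [Fintype A] {η ι δ' : ℝ}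
    {initial : (k : ℕ) → History S A B H k → PMF S} {ν : Policy S B} (hν : G.IsOppPolicy ν)
    (h₀ : ∀ k ω, (initial k ω).support ⊆ (G.states 0 : Set S)) : ∀ (K : ℕ) (ω : History S A B H K),
    ω ∈ (interactionLaw G (epochLearner G η ι δ') (fun _ _ => ν) initial K).support →
      ∀ k, initialStates ω k ∈ G.states 0
  | 0, _, _ => fun k => k.elim0
  | K + 1, ω, hω => by
    obtain ⟨h1, h2⟩ := mem_support_interactionLaw_succ isLearnerPolicy_epochLearner
      (fun _ _ => hν) h₀ hω
    intro k
    refine Fin.lastCases ?_ (fun j => ?_) k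
    · exact (h2 0).1
    · exact initialStates_mem hν h₀ K _ h1 j

variable [Fintype S] [Fintype A] [Fintype B] {ι : ℝ}
  {initial : (k : ℕ) → History S A B H k → PMF S} {ν : Policy S B}

/-- The empirical Nash-value regret of a fixed opponent as a sum along the record. -/
theorem empNashRegret_eq_runSum [NeZero H] [NeZero K] {η δ' : ℝ} (ω : History S A B H K) :
    G.empNashRegret (initialStates ω) (playedPolicies (epochLearner G η ι δ') ω) (fun _ => ν) =
      runSum (fun k ω e => G.optValue ν 0 (e ⟨0, Nat.pos_of_neZero H⟩).1 -
        G.value (epochLearner G η ι δ' k ω) ν 0 (e ⟨0, Nat.pos_of_neZero H⟩).1) K ω := by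
  rw [runSum_eq_sum, MarkovGame.empNashRegret]
  simp only [MarkovGame.empNash_const]
  rfl

/-- With probability at least `1 - δ`, the record is good and all temporal-difference errors
are small. -/
theorem le_toOuterMeasure_goodHistory (hν : G.IsOppPolicy ν)
    (h₀ : ∀ k ω, (initial k ω).support ⊆ (G.states 0 : Set S)) (hH : 0 < H) (hK : 1 ≤ K)
    (hδ : 0 < δ) (hδ1 : δ < 1) (hΛK : logFactor G K δ ≤ K) {η δ' : ℝ} :
    ENNReal.ofReal (1 - δ) ≤
      (interactionLaw G (epochLearner G η ι δ') (fun _ _ => ν) initial K).toOuterMeasure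
        {ω | GoodHistory G ν initial η ι δ' (4 * K ^ 2 * H * G.numStates / δ) K ω ∧
          ∀ h < H, runSum (valueNoise G ν (epochLearner G η ι δ') h) K ω ≤
            2 * H * √(K * logFactor G K δ)} := by
  have hS : (1 : ℝ) ≤ G.numStates := by exact_mod_cast one_le_numStates
  have hA : (1 : ℝ) ≤ G.numActions := by exact_mod_cast one_le_numActions hH
  have hH' : (1 : ℝ) ≤ H := by exact_mod_cast hH
  have hK' : (1 : ℝ) ≤ K := by exact_mod_cast hK
  set Λ := logFactor G K δ with hΛ
  have hΛ1 : 1 ≤ Λ := one_le_logFactor hH hK hδ hδ1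
  -- the scale at which the Gaussian and the linear term of the exponential bound balance
  set lam := √(Λ / K) / H with hlam
  have hlam0 : 0 < lam := by positivity
  have hlamH : lam * H = √(Λ / K) := div_mul_cancel₀ _ (by positivity)
  have hlam2 : K * (lam ^ 2 * H ^ 2) = Λ := by
    rw [← mul_pow, hlamH, Real.sq_sqrt (by positivity)]
    field_simp
  have hlam1 : lam * H ≤ 1 := by
    rw [hlamH]
    exact Real.sqrt_le_one.2 ((div_le_one (by positivity)).2 hΛK)
  set R : ℕ → History S A B H K → ℝ :=
    fun h ω => runSum (valueNoise G ν (epochLearner G η ι δ') h) K ω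
  set Z : History S A B H K → ℝ := fun ω => ∑ h : Fin H,
    Real.exp (lam * R h ω - K * (lam ^ 2 * H ^ 2)) with hZ
  have hZ0 : ∀ ω, 0 ≤ Z ω := fun ω => Finset.sum_nonneg fun _ _ => (Real.exp_pos _).le
  refine le_toOuterMeasure_of_expect_le
    (f := fun ω => δ / (4 * K ^ 2 * H * G.numStates) * deviationSum G ν η ι δ' K ω +
      δ / (2 * H) * Z ω) (fun ω => ?_) (fun ω hω hle => ?_) ?_
  · have := deviationSum_nonneg (G := G) (ν := ν) (η := η) (ι := ι) (δ' := δ') K ω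
    have := hZ0 ω
    positivity
  · have hd0 := deviationSum_nonneg (G := G) (ν := ν) (η := η) (ι := ι) (δ' := δ') K ω
    have h1 : 0 ≤ δ / (4 * K ^ 2 * H * G.numStates) * deviationSum G ν η ι δ' K ω := by positivity
    have h2 : 0 ≤ δ / (2 * H) * Z ω := mul_nonneg (by positivity) (hZ0 ω)
    refine ⟨⟨hω, ?_⟩, fun h hh => ?_⟩
    · rw [le_div_iff₀ hδ]
      have h3 : δ / (4 * K ^ 2 * H * G.numStates) * deviationSum G ν η ι δ' K ω ≤ 1 := by linarith
      rw [div_mul_eq_mul_div, div_le_one (by positivity)] at h3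
      linarith
    · have h3 : δ / (2 * H) * Z ω ≤ 1 := by linarith
      rw [div_mul_eq_mul_div, div_le_one (by positivity), mul_comm, ← le_div_iff₀ hδ] at h3
      have h4 : Real.exp (lam * R h ω - K * (lam ^ 2 * H ^ 2)) ≤ 2 * H / δ :=
        (Finset.single_le_sum (f := fun h : Fin H =>
          Real.exp (lam * R h ω - K * (lam ^ 2 * H ^ 2))) (fun _ _ => (Real.exp_pos _).le)
          (Finset.mem_univ ⟨h, hh⟩)).trans h3
      rw [← Real.le_log_iff_exp_le (by positivity), hlam2] at h4
      have h5 : Real.log (2 * H / δ) ≤ Λ := by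
        refine Real.log_le_log (by positivity) ?_
        have : (2 : ℝ) * H ≤ 8 * H * K * G.numActions * G.numStates := by
          calc (2 : ℝ) * H ≤ 8 * H * 1 * 1 * 1 := by linarith
            _ ≤ _ := by gcongr
        gcongr
      have h6 : lam * R h ω ≤ 2 * Λ := by linarith
      have h7 : lam * (2 * H * √(K * Λ)) = 2 * Λ := by
        have e : √(K * Λ) = K * √(Λ / K) := by
          rw [show (K : ℝ) * Λ = K ^ 2 * (Λ / K) by field_simp, Real.sqrt_mul (sq_nonneg _),
            Real.sqrt_sq (by linarith)]
        calc lam * (2 * H * √(K * Λ)) = 2 * (K * (lam * H * √(Λ / K))) := by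
              rw [e]
              ring
          _ = 2 * Λ := by
            rw [hlamH, Real.mul_self_sqrt (by positivity)]
            field_simp
      exact le_of_mul_le_mul_left (h6.trans h7.ge) hlam0
  · have h1 := expect_deviationSum_le (η := η) (ι := ι) (δ' := δ') hν h₀ K K le_rfl
    have h2 : expect (interactionLaw G (epochLearner G η ι δ') (fun _ _ => ν) initial K) Z ≤ H := by
      rw [hZ, expect_sum]
      refine (Finset.sum_le_sum fun h _ => expect_exp_valueNoise_le
        (fun k ω => isLearnerPolicy_epochLearner k ω) hν h₀ hlam0.le hlam1 h.2 K).trans ?_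
      simp
    rw [expect_add, expect_const_mul, expect_const_mul]
    have h3 : (K : ℝ) * (H * (G.numStates * (K + 1))) ≤ 2 * K ^ 2 * H * G.numStates := by
      calc (K : ℝ) * (H * (G.numStates * (K + 1))) ≤ K * (H * (G.numStates * (K + K))) := by gcongr
        _ = 2 * K ^ 2 * H * G.numStates := by ring
    calc _ ≤ δ / (4 * K ^ 2 * H * G.numStates) * (2 * K ^ 2 * H * G.numStates) +
          δ / (2 * H) * H := by
          gcongr
          exact h1.trans h3
      _ = δ := by
        field_simp
        norm_num

end Main

end

theorem corollary1 :
    ∃ c₀ : ℝ, 0 < c₀ ∧ ∀ c₁ : ℝ, c₀ ≤ c₁ → ∃ (C : ℝ) (p : ℕ), 0 < C ∧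
      ∀ (S A B : Type*) [Fintype S] [DecidableEq S] [Fintype A] [DecidableEq A] [Fintype B]
        (H K : ℕ) [NeZero H] (G : MarkovGame S A B H) (δ ι : ℝ)
        (opponent : (k : ℕ) → History S A B H k → Policy S B)
        (initial : (k : ℕ) → History S A B H k → PMF S) (ν : Policy S B),
        1 ≤ K → 0 < δ → δ < 1 →
        c₀ * (H ^ 2 * G.numActions * logFactor G K δ) ≤ ι →
        ι ≤ c₁ * (H ^ 2 * G.numActions * logFactor G K δ) →
        G.IsOppPolicy ν →
        (∀ k ω, opponent k ω = ν) →
        (∀ k ω, (initial k ω).support ⊆ (G.states 0 : Set S)) →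
        let learner := epochVLearning G K δ (1 / H) ι
        let law := interactionLaw G learner opponent initial K
        let extR : History S A B H K → ℝ := fun ω => G.externalRegret (initialStates ω)
          (playedPolicies learner ω) (playedPolicies opponent ω)
        let enr : History S A B H K → ℝ := fun ω => G.empNashRegret (initialStates ω)
          (playedPolicies learner ω) (playedPolicies opponent ω)
        (∀ ω ∈ law.support, extR ω = enr ω) ∧
        ENNReal.ofReal (1 - δ) ≤ law.toOuterMeasure
          {ω | enr ω ≤ C * √(H ^ 5 * G.numActions * G.numStates * K) * logFactor G K δ ^ p} := by
  refine ⟨625, by norm_num, fun c₁ hc₁ => ⟨15 + 6 * √c₁, 1, by positivity, ?_⟩⟩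
  intro S A B _ _ _ _ _ H K _ G δ ι opponent initial ν hK hδ hδ1 hι hι' hν hopp h₀
  obtain rfl : opponent = fun _ _ => ν := by
    funext k ω
    exact hopp k ω
  have : NeZero K := ⟨by omega⟩
  have hH : 0 < H := Nat.pos_of_neZero H
  set δ' := δ / (4 * H * K * G.numStates) with hδ'
  have hlearner : epochVLearning G K δ (1 / H) ι = epochLearner G (1 / H) ι δ' := rfl
  intro learner law extR enr
  have henr : ∀ ω, enr ω = runSum (fun k ω e => G.optValue ν 0 (e ⟨0, hH⟩).1 -
      G.value (epochLearner G (1 / H) ι δ' k ω) ν 0 (e ⟨0, hH⟩).1) K ω :=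
    fun ω => empNashRegret_eq_runSum ω
  have hS : (1 : ℝ) ≤ G.numStates := by exact_mod_cast one_le_numStates
  have hA : (1 : ℝ) ≤ G.numActions := by exact_mod_cast one_le_numActions hH
  have hH' : (1 : ℝ) ≤ H := by exact_mod_cast hH
  have hK' : (1 : ℝ) ≤ K := by exact_mod_cast hK
  have hΛ : 1 ≤ logFactor G K δ := one_le_logFactor hH hK hδ hδ1
  have hC : 1 ≤ 15 + 6 * √c₁ := by linarith [Real.sqrt_nonneg c₁]
  refine ⟨fun ω hω => MarkovGame.externalRegret_const hν _ (initialStates_mem hν h₀ K ω hω) _, ?_⟩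
  by_cases hcase : (K : ℝ) < H * G.numStates ∨ (K : ℝ) < logFactor G K δ
  · refine le_toOuterMeasure_of_expect_le (f := fun _ => 0) (fun _ => le_rfl)
      (fun ω hω _ => ?_) ((expect_const _ _).trans_le hδ.le)
    have h1 : enr ω ≤ K * H := by
      rw [henr, ← runSum_const (S := S) (A := A) (B := B) (H := H) (H : ℝ) K ω]
      refine runSum_mono (G := G) (P := fun k ω => ω ∈ (interactionLaw G
        (epochLearner G (1 / H) ι δ') (fun _ _ => ν) initial k).support)
        (fun k ω hω => mem_support_interactionLaw_succ isLearnerPolicy_epochLearner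
          (fun _ _ => hν) h₀ hω) (fun k ω e _ he => ?_) K ω hω
      have h2 := MarkovGame.optValue_mem hν H 0 (Nat.zero_add H) _ (he ⟨0, hH⟩).1
      have h3 := MarkovGame.value_mem (isLearnerPolicy_epochLearner (η := 1 / H) (ι := ι)
        (δ' := δ') k ω) hν H 0 (Nat.zero_add H) _ (he ⟨0, hH⟩).1
      linarith [h2.2, h3.1]
    refine h1.trans ((trivial_arithmetic hH' hS hA hK' hΛ hcase).trans ?_)
    rw [pow_one, mul_assoc (15 + 6 * √c₁)]
    exact le_mul_of_one_le_left (by positivity) hC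
  · rw [not_or, not_lt, not_lt] at hcase
    refine (le_toOuterMeasure_goodHistory (ι := ι) (η := 1 / H) (δ' := δ') hν h₀ hH hK hδ hδ1
      hcase.2).trans (MeasureTheory.measure_mono ?_)
    rintro ω ⟨hgood, hnoise⟩
    have hθ : 0 < √(H * G.numStates * logFactor G K δ / K) := by positivity
    have h1 := GoodHistory.regret_le hν h₀ (confidenceParams hH hK hδ hδ1 hι) hθ hK hH hgood
      (by positivity) hnoise
    rw [Set.mem_ofPred_eq, henr, pow_one]
    refine h1.trans (regret_arithmetic hH' hS hA hΛ ?_ hcase.1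
      (by linarith) hι')
    refine log_le_logFactor hH hK hδ hδ1 (by linarith) ?_
    calc (K : ℝ) = 1 * 1 * K * 1 * 1 := by ring
      _ ≤ 8 * H * K * G.numActions * G.numStates := by
        gcongr
        norm_num
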